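/- **Proposition 3.1.** Let $X$ and $Y$ be disjoint $C^2$ submanifolds of $\mathbb{R}^n$, definable (with real parameters) in a polynomially bounded o-minimal expansion of the ordered field of real numbers, with $\dim X=1$ and $0\in X\cap \mathrm{cl}(Y)$. Let $\pi$ be the canonical local retraction onto $X$, which sends a point $y$ near $0$ to its unique nearest point on $X$. For a vector $v$ and linear subspaces $A,B$ of $\mathbb{R}^n$ put $$\eta(v,B)=\sup\{\langle v,u\rangle : u\in B^\perp,\ |u|=1\},\qquad \delta(A,B)=\sup\{\eta(v,B): v\in A,\ |v|=1\},$$ where a supremum over the empty set is $0$ (so $\eta(v,B)$ is the distance from $v$ to $B$), and for $y\in Y$ near $0$ put $$\alpha(y)=\delta\big(T_{\pi(y)}X,\,T_yY\big),\qquad \beta(y)=\eta\Big(\tfrac{y-\pi(y)}{|y-\pi(y)|},\,T_yY\Big).$$ If $(Y,X)$ satisfies Whitney's condition $(b)$ at $0$, that is, $\alpha(y)\to0$ and $\beta(y)\to 0$ as $y\to0$ on $Y$, then $(Y,X)$ satisfies Kuo's ratio test $(r)$ at $0$, that is, $$\frac{|y|\,\alpha(y)}{|y-\pi(y)|}\longrightarrow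 0\quad\text{as } y\to 0 \text{ on } Y.$$ (A structure is o-minimal if every definable subset of $\mathbb{R}$ is a finite union of points and open intervals, and polynomially bounded if for every definable $f:\mathbb{R}\to\mathbb{R}$ there is $N\in\mathbb{N}$ with $|f(t)|\le t^N$ for all sufficiently large $t$.) -/

import Mathlib

open Filter Topology

noncomputable section

/-! ### Polynomially bounded o-minimal structures on the real field

A structure on `ℝ` is a first-order language `L` interpreted in `ℝ`; "definable" means definable by
an `L`-formula with arbitrary real parameters. -/

/-- `L` interpreted in `ℝ` is an o-minimal expansion of the ordered real field. -/
structure IsOMinimalExpansion (L : FirstOrder.Language) [L.Structure ℝ] : Prop where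
  definable_lt : (Set.univ : Set ℝ).Definable L {v : Fin 2 → ℝ | v 0 < v 1}
  definable_add : (Set.univ : Set ℝ).Definable L {v : Fin 3 → ℝ | v 0 + v 1 = v 2}
  definable_mul : (Set.univ : Set ℝ).Definable L {v : Fin 3 → ℝ | v 0 * v 1 = v 2}
  /-- Every definable subset of the line is a finite union of points and open intervals, bounded
  or not. -/
  finite_union : ∀ S : Set ℝ, (Set.univ : Set ℝ).Definable₁ L S →
    ∃ 𝓘 : Set (Set ℝ), 𝓘.Finite ∧
      (∀ J ∈ 𝓘, (∃ a : ℝ, J = {a}) ∨ (∃ a b : EReal, J = {x : ℝ | a < (x : EReal) ∧ (x : EReal) < b})) ∧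
      S = ⋃₀ 𝓘

/-- Every definable function `ℝ → ℝ` is bounded by a power of `t` as `t → +∞`. -/
def IsPolynomiallyBounded (L : FirstOrder.Language) [L.Structure ℝ] : Prop :=
  ∀ f : ℝ → ℝ, (Set.univ : Set ℝ).Definable L {v : Fin 2 → ℝ | v 1 = f (v 0)} →
    ∃ N : ℕ, ∀ᶠ t : ℝ in atTop, |f t| ≤ t ^ N

/-- Definability of a subset of Euclidean space (which is `Fin n → ℝ` with the Euclidean norm). -/
def IsDefinableSet (L : FirstOrder.Language) [L.Structure ℝ] {n : ℕ}
    (S : Set (EuclideanSpace ℝ (Fin n))) : Prop :=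
  (Set.univ : Set ℝ).Definable L {v : Fin n → ℝ | WithLp.toLp 2 v ∈ S}

section Geometry

variable {n : ℕ}

/-! ### Submanifolds of Euclidean space and their tangent spaces -/

/-- `M` is an (embedded) submanifold of `ℝⁿ` of class `C^2` and dimension `d`: around each of its
points some `C^2` diffeomorphism between open subsets of `ℝⁿ` straightens `M` to a
`d`-dimensional linear subspace. -/
def IsC2Submanifold (d : ℕ) (M : Set (EuclideanSpace ℝ (Fin n))) : Prop :=
  ∀ x ∈ M, ∃ (Φ : OpenPartialHomeomorph (EuclideanSpace ℝ (Fin n)) (EuclideanSpace ℝ (Fin n)))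
    (V : Submodule ℝ (EuclideanSpace ℝ (Fin n))),
    x ∈ Φ.source ∧ ContDiffOn ℝ 2 Φ Φ.source ∧ ContDiffOn ℝ 2 Φ.symm Φ.target ∧
    Module.finrank ℝ V = d ∧ ∀ z ∈ Φ.source, (z ∈ M ↔ Φ z ∈ V)

/-- The tangent space `T_x M`, spanned by the velocities at `x` of curves in `M` through `x`
(at a point of a submanifold these velocities already form a linear subspace). -/
def tangentSpaceAt (M : Set (EuclideanSpace ℝ (Fin n))) (x : EuclideanSpace ℝ (Fin n)) :
    Submodule ℝ (EuclideanSpace ℝ (Fin n)) :=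
  Submodule.span ℝ {v | ∃ γ : ℝ → EuclideanSpace ℝ (Fin n),
    γ 0 = x ∧ (∀ᶠ t in 𝓝 (0 : ℝ), γ t ∈ M) ∧ HasDerivAt γ v 0}

/-! ### The canonical retraction and the angles between tangent spaces -/

/-- The canonical retraction `π` onto `X`, sending `y` to its nearest point on `X`. Near any given
point of a `C^2` submanifold `X` this point exists and is unique; the value is only used there. -/
def nearestPoint (X : Set (EuclideanSpace ℝ (Fin n))) (y : EuclideanSpace ℝ (Fin n)) :
    EuclideanSpace ℝ (Fin n) :=
  Classical.epsilon fun x => x ∈ X ∧ ∀ z ∈ X, dist y x ≤ dist y z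

/-- The distance of the vector `v` to the linear subspace `B`,
`η(v, B) = sup { ⟨v, u⟩ : u ∈ Bᗮ, |u| = 1 }` (which is `0` if `B` is the whole space). -/
def distToSubspace (v : EuclideanSpace ℝ (Fin n))
    (B : Submodule ℝ (EuclideanSpace ℝ (Fin n))) : ℝ :=
  sSup {r : ℝ | ∃ u ∈ Bᗮ, ‖u‖ = 1 ∧ r = inner ℝ v u}

/-- `δ(A, B) = sup { η(v, B) : v ∈ A, |v| = 1 }`. -/
def subspaceDelta (A B : Submodule ℝ (EuclideanSpace ℝ (Fin n))) : ℝ :=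
  sSup {r : ℝ | ∃ v ∈ A, ‖v‖ = 1 ∧ r = distToSubspace v B}

/-- `α(y) = δ(T_{π(y)} X, T_y Y)`. -/
def tangentAngle (Y X : Set (EuclideanSpace ℝ (Fin n))) (y : EuclideanSpace ℝ (Fin n)) : ℝ :=
  subspaceDelta (tangentSpaceAt X (nearestPoint X y)) (tangentSpaceAt Y y)

/-- `β(y)`, the distance of the unit vector `(y - π(y)) / |y - π(y)|` to `T_y Y`. -/
def secantAngle (Y X : Set (EuclideanSpace ℝ (Fin n))) (y : EuclideanSpace ℝ (Fin n)) : ℝ :=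
  distToSubspace (‖y - nearestPoint X y‖⁻¹ • (y - nearestPoint X y)) (tangentSpaceAt Y y)

/-! ### Whitney's condition (b) and Kuo's ratio test (r) -/

/-- Whitney's condition (b) for `(Y, X)` at `x₀`: `α(y) → 0` and `β(y) → 0` as `y → x₀` on `Y`. -/
def WhitneyBAt (Y X : Set (EuclideanSpace ℝ (Fin n))) (x₀ : EuclideanSpace ℝ (Fin n)) : Prop :=
  Tendsto (tangentAngle Y X) (𝓝[Y] x₀) (𝓝 0) ∧ Tendsto (secantAngle Y X) (𝓝[Y] x₀) (𝓝 0)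

/-- Kuo's ratio test (r) for `(Y, X)` at `x₀`:
`|y - x₀| α(y) / |y - π(y)| → 0` as `y → x₀` on `Y`. -/
def KuoRatioTestAt (Y X : Set (EuclideanSpace ℝ (Fin n))) (x₀ : EuclideanSpace ℝ (Fin n)) : Prop :=
  Tendsto (fun y => ‖y - x₀‖ * tangentAngle Y X y / ‖y - nearestPoint X y‖) (𝓝[Y] x₀) (𝓝 0)

end Geometry

end

/-! Suppose the ratio test fails. Definable choice then gives definable curves `y` in `Y` with `‖y
t‖ = t` and `x = π(y)` in `X`, along which some unit `v` tangent to `X` at `x t` and unit `u` normal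
to `Y` at `y t` satisfy `(ε/2) ρ < t ⟨v, u⟩`, where `ρ = ‖y - x‖`.

Write `y - x = ρ U` with `U` a unit vector, so that `y' - x' = ρ' U + ρ U'`. Polynomial boundedness
enters through one estimate: a definable germ `f → 0` satisfies `t f' = O(f)`
(`IsPolynomiallyBounded.exists_mul_deriv_le`). For `f = ρ` this gives `t ρ' = O(ρ)`. Each coordinate
of `U` is bounded and definable, hence has a limit, and the estimate for the difference gives `t U'
→ 0`.

Pair with `u`. As `y'` is tangent to `Y`, `t ⟨x', u⟩ = -(t ρ' ⟨U, u⟩ + ρ ⟨t U', u⟩)`, and `|⟨U, u⟩|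
≤ β(y) → 0` makes this `o(ρ)`. Moreover `⟨v, u⟩ ≤ α(y) → 0` gives `ρ = o(t)`, hence `y' - x' → 0`;
since `‖y'‖ ≥ 1`, `x'` stays away from `0`. Because `dim X = 1`, `v` is a bounded multiple of `x'`,
so `t ⟨v, u⟩ = o(ρ)`, a contradiction.

Only arbitrarily small parameters at which the curves are differentiable are needed. The
monotonicity theorem and Lebesgue's theorem on monotone functions supply them. To apply definable
choice, tangency is rewritten in first-order terms through normal vectors (`isNormalAt_iff`). -/

noncomputable section

/-! ### A calculus of definable predicates and functions -/

/-- A type identified with a finite power of `ℝ`. -/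
class RealCoordinates (E : Type) where
  /-- The index set of the coordinates. -/
  index : Type
  finite_index : Finite index
  /-- The tuple of coordinates of a point. -/
  coords : E ≃ (index → ℝ)

attribute [instance] RealCoordinates.finite_index

open RealCoordinates

instance : RealCoordinates ℝ := ⟨Unit, inferInstance, (Equiv.funUnique Unit ℝ).symm⟩

instance (n : ℕ) : RealCoordinates (Fin n → ℝ) := ⟨Fin n, inferInstance, Equiv.refl _⟩

instance (n : ℕ) : RealCoordinates (EuclideanSpace ℝ (Fin n)) :=
  ⟨Fin n, inferInstance, WithLp.equiv 2 _⟩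

instance (E F : Type) [RealCoordinates E] [RealCoordinates F] : RealCoordinates (E × F) :=
  ⟨index E ⊕ index F, inferInstance,
    (Equiv.prodCongr coords coords).trans (Equiv.sumArrowEquivProdArrow _ _ _).symm⟩

section Calculus

variable (L : FirstOrder.Language) [L.Structure ℝ]
variable {E F G : Type} [RealCoordinates E] [RealCoordinates F] [RealCoordinates G]

/-- A predicate is definable (with parameters) in coordinates. -/
def DefinablePred (P : E → Prop) : Prop :=
  (Set.univ : Set ℝ).Definable L {v : index E → ℝ | P (coords.symm v)}

/-- A function is definable if its graph is. -/
def DefinableMap (f : E → F) : Prop :=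
  DefinablePred L fun p : E × F => f p.1 = p.2

variable {L}

namespace DefinablePred

variable {P Q : E → Prop}

theorem and (hP : DefinablePred L P) (hQ : DefinablePred L Q) :
    DefinablePred L fun p => P p ∧ Q p :=
  Set.Definable.inter hP hQ

theorem or (hP : DefinablePred L P) (hQ : DefinablePred L Q) :
    DefinablePred L fun p => P p ∨ Q p :=
  Set.Definable.union hP hQ

theorem not (hP : DefinablePred L P) : DefinablePred L fun p => ¬ P p :=
  Set.Definable.compl hP

theorem congr (hP : DefinablePred L P) (h : ∀ p, Q p ↔ P p) : DefinablePred L Q := by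
  rwa [show Q = P from funext fun p => propext (h p)]

theorem imp (hP : DefinablePred L P) (hQ : DefinablePred L Q) :
    DefinablePred L fun p => P p → Q p :=
  (hP.not.or hQ).congr fun _ => imp_iff_not_or

theorem forall_finite {ι : Type} [Finite ι] {P : ι → E → Prop} (h : ∀ i, DefinablePred L (P i)) :
    DefinablePred L fun p => ∀ i, P i p := by
  have := Set.definable_iInter_of_finite h
  unfold DefinablePred
  convert! this using 1
  ext; simp

theorem ex {P : E → F → Prop} (h : DefinablePred L fun q : E × F => P q.1 q.2) :
    DefinablePred L fun p => ∃ x, P p x := by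
  have := Set.Definable.exists_of_finite (α := index E) (β := index F) h
  unfold DefinablePred
  convert! this using 1
  ext v
  constructor
  · rintro ⟨x, hx⟩
    refine ⟨coords x, ?_⟩
    change P (coords.symm v) (coords.symm (coords x))
    simpa using hx
  · rintro ⟨u, hu⟩
    exact ⟨coords.symm u, hu⟩

theorem all {P : E → F → Prop} (h : DefinablePred L fun q : E × F => P q.1 q.2) :
    DefinablePred L fun p => ∀ x, P p x :=
  (ex (P := fun p x => ¬ P p x) h.not).not.congr fun _ => by simp

/-- Definability is preserved under substitution of coordinates for coordinates. -/
theorem reindex {P : F → Prop} (h : DefinablePred L P) (f : E → F) (σ : index F → index E)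
    (hf : ∀ p i, coords (f p) i = coords p (σ i)) : DefinablePred L fun p => P (f p) := by
  have := Set.Definable.preimage_comp σ h
  unfold DefinablePred
  convert! this using 1
  ext v
  have : coords.symm (v ∘ σ) = f (coords.symm v) := by
    rw [Equiv.symm_apply_eq]
    ext i
    simp [hf]
  simp [this]

theorem snd {P : F → Prop} (h : DefinablePred L P) : DefinablePred L fun p : E × F => P p.2 :=
  h.reindex Prod.snd Sum.inr fun _ _ => rfl

theorem comp {P : F → Prop} {f : E → F} (h : DefinablePred L P) (hf : DefinableMap L f) :
    DefinablePred L fun p => P (f p) :=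
  (ex (P := fun p q => f p = q ∧ P q) (and hf h.snd)).congr fun _ => by simp

theorem coord_eq (i j : index E) : DefinablePred L fun p : E => coords p i = coords p j := by
  refine ⟨(FirstOrder.Language.var i).equal (FirstOrder.Language.var j), ?_⟩
  ext v
  simp

theorem coord_eq_const (i : index E) (a : ℝ) : DefinablePred L fun p : E => coords p i = a := by
  have := Set.Definable.preimage_comp (β := index E) (fun _ : Fin 1 => i)
    (Set.Definable.singleton_of_mem L (Set.mem_univ a))
  unfold DefinablePred
  convert! this using 1
  ext v
  simp

theorem map_eq_of_coords {f : E → F} (σ : index F → index E)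
    (hf : ∀ p i, coords (f p) i = coords p (σ i)) : DefinableMap L f := by
  refine (forall_finite (E := E × F) (P := fun (i : index F) p => coords p (Sum.inl (σ i)) =
    coords p (Sum.inr i)) fun i => coord_eq (E := E × F) _ _).congr fun p => ?_
  rw [← coords.injective.eq_iff, funext_iff]
  simp only [hf]
  rfl

end DefinablePred

open DefinablePred

namespace DefinableMap

theorem id : DefinableMap L fun p : E => p := map_eq_of_coords (fun i => i) fun _ _ => rfl

theorem fst : DefinableMap L fun p : E × F => p.1 := map_eq_of_coords Sum.inl fun _ _ => rfl

theorem snd : DefinableMap L fun p : E × F => p.2 := map_eq_of_coords Sum.inr fun _ _ => rfl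

theorem comp {g : F → G} {f : E → F} (hg : DefinableMap L g) (hf : DefinableMap L f) :
    DefinableMap L fun p => g (f p) := by
  refine (ex (E := E × G) (P := fun p q => f p.1 = q ∧ g q = p.2) (and ?_ ?_)).congr
    fun _ => by simp
  · exact reindex hf (fun p : (E × G) × F => (p.1.1, p.2))
      (Sum.elim (fun i => Sum.inl (Sum.inl i)) Sum.inr) (by rintro p (i | i) <;> rfl)
  · exact reindex hg (fun p : (E × G) × F => (p.2, p.1.2))
      (Sum.elim Sum.inr (fun i => Sum.inl (Sum.inr i))) (by rintro p (i | i) <;> rfl)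

theorem prodMk {f : E → F} {g : E → G} (hf : DefinableMap L f) (hg : DefinableMap L g) :
    DefinableMap L fun p => (f p, g p) := by
  refine (and (E := E × (F × G)) (P := fun p => f p.1 = p.2.1) (Q := fun p => g p.1 = p.2.2)
    ?_ ?_).congr fun _ => Prod.ext_iff
  · exact DefinablePred.comp (P := fun p : E × F => f p.1 = p.2)
      (f := fun p : E × (F × G) => (p.1, p.2.1)) hf
      (map_eq_of_coords (Sum.elim Sum.inl fun i => Sum.inr (Sum.inl i))
        (by rintro p (i | i) <;> rfl))
  · exact DefinablePred.comp (P := fun p : E × G => g p.1 = p.2)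
      (f := fun p : E × (F × G) => (p.1, p.2.2)) hg
      (map_eq_of_coords (Sum.elim Sum.inl fun i => Sum.inr (Sum.inr i))
        (by rintro p (i | i) <;> rfl))

end DefinableMap

theorem DefinableMap.fst' {f : E → F × G} (hf : DefinableMap L f) :
    DefinableMap L fun p => (f p).1 :=
  DefinableMap.comp DefinableMap.fst hf

theorem DefinableMap.snd' {f : E → F × G} (hf : DefinableMap L f) :
    DefinableMap L fun p => (f p).2 :=
  DefinableMap.comp DefinableMap.snd hf

theorem DefinablePred.comp₂ {P : F → G → Prop} {f : E → F} {g : E → G}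
    (h : DefinablePred L fun q : F × G => P q.1 q.2) (hf : DefinableMap L f)
    (hg : DefinableMap L g) : DefinablePred L fun p => P (f p) (g p) :=
  DefinablePred.comp h (hf.prodMk hg)

theorem DefinableMap.comp₂ {H : Type} [RealCoordinates H] {P : F → G → H} {f : E → F} {g : E → G}
    (h : DefinableMap L fun q : F × G => P q.1 q.2) (hf : DefinableMap L f)
    (hg : DefinableMap L g) : DefinableMap L fun p => P (f p) (g p) :=
  DefinableMap.comp h (hf.prodMk hg)

theorem DefinablePred.eq {f g : E → F} (hf : DefinableMap L f) (hg : DefinableMap L g) :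
    DefinablePred L fun p => f p = g p :=
  DefinablePred.comp₂ (P := fun a b : F => a = b) DefinableMap.id hf hg

theorem DefinableMap.of_coords {f : E → F} (h : ∀ i, DefinableMap L fun p => coords (f p) i) :
    DefinableMap L f := by
  refine (forall_finite (E := E × F) (P := fun (i : index F) p => coords (f p.1) i =
    coords p.2 i) fun i => ?_).congr fun p => ?_
  · exact DefinablePred.eq ((h i).comp DefinableMap.fst)
      (DefinableMap.comp (g := fun p : F => coords p i)
        (map_eq_of_coords (fun _ => i) fun _ _ => rfl) DefinableMap.snd)
  · rw [← coords.injective.eq_iff, funext_iff]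

theorem DefinableMap.const (c : F) : DefinableMap L fun _ : E => c := by
  refine DefinableMap.of_coords fun i => ?_
  refine (coord_eq_const (E := E × ℝ) (Sum.inr ()) (coords c i)).congr fun p => ?_
  exact eq_comm

/-! ### Definability of the field operations -/

section Field

theorem IsOMinimalExpansion.definablePred_lt (hL : IsOMinimalExpansion L) :
    DefinablePred L fun p : ℝ × ℝ => p.1 < p.2 := by
  have h : DefinablePred L fun v : Fin 2 → ℝ => v 0 < v 1 := hL.definable_lt
  exact h.reindex (fun p : ℝ × ℝ => ![p.1, p.2]) ![Sum.inl (), Sum.inr ()]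
    fun p (i : Fin 2) => by fin_cases i <;> rfl

theorem IsOMinimalExpansion.definableMap_add (hL : IsOMinimalExpansion L) :
    DefinableMap L fun p : ℝ × ℝ => p.1 + p.2 := by
  have h : DefinablePred L fun v : Fin 3 → ℝ => v 0 + v 1 = v 2 := hL.definable_add
  exact h.reindex (fun p : (ℝ × ℝ) × ℝ => ![p.1.1, p.1.2, p.2])
    ![Sum.inl (Sum.inl ()), Sum.inl (Sum.inr ()), Sum.inr ()]
    fun p (i : Fin 3) => by fin_cases i <;> rfl

theorem IsOMinimalExpansion.definableMap_mul (hL : IsOMinimalExpansion L) :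
    DefinableMap L fun p : ℝ × ℝ => p.1 * p.2 := by
  have h : DefinablePred L fun v : Fin 3 → ℝ => v 0 * v 1 = v 2 := hL.definable_mul
  exact h.reindex (fun p : (ℝ × ℝ) × ℝ => ![p.1.1, p.1.2, p.2])
    ![Sum.inl (Sum.inl ()), Sum.inl (Sum.inr ()), Sum.inr ()]
    fun p (i : Fin 3) => by fin_cases i <;> rfl

variable {f g : E → ℝ}

theorem DefinablePred.lt (hL : IsOMinimalExpansion L)
    (hf : DefinableMap L f) (hg : DefinableMap L g) :
    DefinablePred L fun p => f p < g p :=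
  DefinablePred.comp₂ (P := fun a b : ℝ => a < b) hL.definablePred_lt hf hg

theorem DefinablePred.le (hL : IsOMinimalExpansion L)
    (hf : DefinableMap L f) (hg : DefinableMap L g) :
    DefinablePred L fun p => f p ≤ g p :=
  (DefinablePred.lt hL hg hf).not.congr fun _ => not_lt.symm

namespace DefinableMap

theorem add (hL : IsOMinimalExpansion L) (hf : DefinableMap L f) (hg : DefinableMap L g) :
    DefinableMap L fun p => f p + g p :=
  DefinableMap.comp₂ (P := fun a b : ℝ => a + b) hL.definableMap_add hf hg

theorem mul (hL : IsOMinimalExpansion L) (hf : DefinableMap L f) (hg : DefinableMap L g) :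
    DefinableMap L fun p => f p * g p :=
  DefinableMap.comp₂ (P := fun a b : ℝ => a * b) hL.definableMap_mul hf hg

theorem neg (hL : IsOMinimalExpansion L)
    (hf : DefinableMap L f) : DefinableMap L fun p => - f p := by
  simpa using (const (-1)).mul hL hf

theorem sub (hL : IsOMinimalExpansion L) (hf : DefinableMap L f) (hg : DefinableMap L g) :
    DefinableMap L fun p => f p - g p := by
  simpa [sub_eq_add_neg] using hf.add hL (hg.neg hL)

theorem inv (hL : IsOMinimalExpansion L)
    (hf : DefinableMap L f) : DefinableMap L fun p => (f p)⁻¹ := by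
  have h : DefinableMap L fun a : ℝ => a⁻¹ := by
    refine ((DefinablePred.eq (mul hL fst snd) (const (1 : ℝ))).or
      ((DefinablePred.eq fst (const (0 : ℝ))).and
        (DefinablePred.eq snd (const (0 : ℝ))))).congr fun p : ℝ × ℝ => ?_
    rcases eq_or_ne p.1 0 with h | h
    · simp [h, eq_comm]
    · exact ⟨fun e => Or.inl (e ▸ mul_inv_cancel₀ h),
        fun e => inv_eq_of_mul_eq_one_right (e.resolve_right fun e => h e.1)⟩
  exact h.comp hf

theorem pow (hL : IsOMinimalExpansion L)
    (hf : DefinableMap L f) (N : ℕ) : DefinableMap L fun p => f p ^ N := by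
  induction N with
  | zero => simpa using const (1 : ℝ)
  | succ N ih => simpa [pow_succ] using ih.mul hL hf

theorem sum (hL : IsOMinimalExpansion L)
    {ι : Type} (s : Finset ι) {f : ι → E → ℝ} (hf : ∀ i, DefinableMap L (f i)) :
    DefinableMap L fun p => ∑ i ∈ s, f i p := by
  classical
  induction s using Finset.induction_on with
  | empty => simpa using const (0 : ℝ)
  | insert i s hi ih => simpa [Finset.sum_insert hi] using (hf i).add hL ih

variable {n : ℕ} {u v : E → EuclideanSpace ℝ (Fin n)}

theorem apply (hu : DefinableMap L u) (i : Fin n) : DefinableMap L fun p => u p i :=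
  DefinableMap.comp (g := fun y : EuclideanSpace ℝ (Fin n) => y i)
    (map_eq_of_coords (fun _ => i) fun _ _ => rfl) hu

theorem toEuclidean (h : ∀ i, DefinableMap L fun p => u p i) : DefinableMap L u :=
  of_coords h

theorem inner (hL : IsOMinimalExpansion L) (hu : DefinableMap L u) (hv : DefinableMap L v) :
    DefinableMap L fun p => inner ℝ (u p) (v p) := by
  simpa [PiLp.inner_apply] using sum hL Finset.univ fun i => (hv.apply i).mul hL (hu.apply i)

theorem norm (hL : IsOMinimalExpansion L)
    (hu : DefinableMap L u) : DefinableMap L fun p => ‖u p‖ := by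
  refine ((DefinablePred.le hL (const 0) snd).and (DefinablePred.eq (pow hL snd 2)
    ((hu.inner hL hu).comp fst))).congr fun p : E × ℝ => ?_
  rw [real_inner_self_eq_norm_sq]
  constructor
  · rintro h
    simp [← h]
  · rintro ⟨h0, h⟩
    exact ((sq_eq_sq₀ h0 (norm_nonneg _)).1 h).symm

theorem vsub (hL : IsOMinimalExpansion L) (hu : DefinableMap L u) (hv : DefinableMap L v) :
    DefinableMap L fun p => u p - v p :=
  toEuclidean fun i => (hu.apply i).sub hL (hv.apply i)

end DefinableMap

end Field

end Calculus

/-! ### Definable functions of one variable -/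

/-- If `J` has points arbitrarily close to `a` on the right, convexity fills the gaps between them.
-/
theorem Set.OrdConnected.eventually_nhdsGT_or {J : Set ℝ} (hJ : J.OrdConnected) (a : ℝ) :
    (∀ᶠ x in 𝓝[>] a, x ∈ J) ∨ ∀ᶠ x in 𝓝[>] a, x ∉ J := by
  by_cases h : ∃ᶠ x in 𝓝[>] a, x ∈ J
  · left
    obtain ⟨b, hb, hab⟩ := (h.and_eventually self_mem_nhdsWithin).exists
    filter_upwards [Ioo_mem_nhdsGT hab] with y hy
    obtain ⟨c, hc, hac⟩ := (h.and_eventually (Ioo_mem_nhdsGT hy.1)).exists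
    exact hJ.out hc hb ⟨hac.2.le, hy.2.le⟩
  · right
    simpa using h

theorem Set.OrdConnected.eventually_nhdsLT_or {J : Set ℝ} (hJ : J.OrdConnected) (a : ℝ) :
    (∀ᶠ x in 𝓝[<] a, x ∈ J) ∨ ∀ᶠ x in 𝓝[<] a, x ∉ J := by
  by_cases h : ∃ᶠ x in 𝓝[<] a, x ∈ J
  · left
    obtain ⟨b, hb, hab⟩ := (h.and_eventually self_mem_nhdsWithin).exists
    filter_upwards [Ioo_mem_nhdsLT hab] with y hy
    obtain ⟨c, hc, hac⟩ := (h.and_eventually (Ioo_mem_nhdsLT hy.2)).exists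
    exact hJ.out hb hc ⟨hy.1.le, hac.1.le⟩
  · right
    simpa using h

/-- A function that does not decrease locally to the right and locally from the left of each point
of an interval is monotone there. -/
theorem monotoneOn_Ioo_of_eventually {f : ℝ → ℝ} {a b : ℝ}
    (hr : ∀ x ∈ Set.Ioo a b, ∀ᶠ y in 𝓝[>] x, f x ≤ f y)
    (hl : ∀ x ∈ Set.Ioo a b, ∀ᶠ y in 𝓝[<] x, f y ≤ f x) : MonotoneOn f (Set.Ioo a b) := by
  intro x hx y hy hxy
  -- Real induction: the left condition carries the inequality to `sSup S`, and the right condition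
  -- carries it past `sSup S` unless that is already `y`.
  let S : Set ℝ := {s | s ∈ Set.Icc x y ∧ ∀ r ∈ Set.Icc x s, f x ≤ f r}
  have hxS : x ∈ S := ⟨⟨le_rfl, hxy⟩, fun r hr => by rw [le_antisymm hr.1 hr.2]⟩
  have hbdd : BddAbove S := ⟨y, fun s hs => hs.1.2⟩
  have hxs : x ≤ sSup S := le_csSup hbdd hxS
  have hsy : sSup S ≤ y := csSup_le ⟨x, hxS⟩ fun s hs => hs.1.2
  have hlt : ∀ r, x ≤ r → r < sSup S → f x ≤ f r := fun r hxr hr => by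
    obtain ⟨s, hs, hrs⟩ := exists_lt_of_lt_csSup ⟨x, hxS⟩ hr
    exact hs.2 r ⟨hxr, hrs.le⟩
  have hsI : sSup S ∈ Set.Ioo a b := ⟨hx.1.trans_le hxs, hsy.trans_lt hy.2⟩
  have hs : f x ≤ f (sSup S) := by
    rcases hxs.eq_or_lt with h | h
    · rw [← h]
    · obtain ⟨r, hr, hxr⟩ := ((hl _ hsI).and (Ioo_mem_nhdsLT h)).exists
      exact (hlt r hxr.1.le hxr.2).trans hr
  rcases hsy.eq_or_lt with h | h
  · rwa [← h]
  · obtain ⟨c, hc, hcI⟩ := mem_nhdsGT_iff_exists_Ioo_subset.1 (hr _ hsI)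
    obtain ⟨d, hd⟩ := exists_between (lt_min hc h)
    have hdS : d ∈ S := by
      refine ⟨⟨hxs.trans hd.1.le, (hd.2.trans_le (min_le_right _ _)).le⟩, fun r hr => ?_⟩
      rcases lt_trichotomy r (sSup S) with h' | h' | h'
      · exact hlt r hr.1 h'
      · rwa [h']
      · exact hs.trans (hcI ⟨h', hr.2.trans_lt (hd.2.trans_le (min_le_left _ _))⟩)
    exact absurd (le_csSup hbdd hdS) (not_le.2 hd.1)

/-- Each such point is the strict minimum on an interval with rational endpoints, and an interval
has at most one strict minimum. This excludes definable functions with a strict local extremum at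
every point of an interval. -/
theorem countable_setOf_strict_local_min (f : ℝ → ℝ) :
    {x | (∀ᶠ y in 𝓝[>] x, f x < f y) ∧ ∀ᶠ y in 𝓝[<] x, f x < f y}.Countable := by
  have h : ∀ x, ((∀ᶠ y in 𝓝[>] x, f x < f y) ∧ ∀ᶠ y in 𝓝[<] x, f x < f y) →
      ∃ q : ℚ × ℚ, (q.1 : ℝ) < x ∧ x < q.2 ∧ ∀ y, (q.1 : ℝ) < y → y < q.2 → y ≠ x → f x < f y := by
    rintro x ⟨hr, hl⟩
    obtain ⟨b, hb, hbI⟩ := mem_nhdsGT_iff_exists_Ioo_subset.1 hr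
    obtain ⟨a, ha, haI⟩ := mem_nhdsLT_iff_exists_Ioo_subset.1 hl
    obtain ⟨p, hp⟩ := exists_rat_btwn (Set.mem_Iio.1 ha)
    obtain ⟨q, hq⟩ := exists_rat_btwn (Set.mem_Ioi.1 hb)
    refine ⟨(p, q), hp.2, hq.1, fun y h1 h2 hne => ?_⟩
    rcases hne.lt_or_gt with h | h
    · exact haI ⟨hp.1.trans h1, h⟩
    · exact hbI ⟨h, h2.trans hq.2⟩
  choose! q hq using h
  refine Set.countable_of_injective_of_countable_image (f := q) ?_ (Set.to_countable _)
  intro x hx y hy hxy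
  by_contra hne
  have h1 := (hq x hx).2.2 y (hxy ▸ (hq y hy).1) (hxy ▸ (hq y hy).2.1) (Ne.symm hne)
  have h2 := (hq y hy).2.2 x (hxy ▸ (hq x hx).1) (hxy ▸ (hq x hx).2.1) hne
  exact lt_asymm h1 h2

section OMinimal

variable {L : FirstOrder.Language} [L.Structure ℝ]

/-- Makes the local behaviour of a definable function at `x` a definable condition on `x`, to which
o-minimality applies again. -/
theorem DefinablePred.eventually_nhdsGT (hL : IsOMinimalExpansion L) {P : ℝ → ℝ → Prop}
    (h : DefinablePred L fun q : ℝ × ℝ => P q.1 q.2) :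
    DefinablePred L fun x => ∀ᶠ y in 𝓝[>] x, P x y := by
  refine (ex (P := fun x b => x < b ∧ ∀ y, x < y ∧ y < b → P x y) (and ?_
    (all (P := fun (q : ℝ × ℝ) y => q.1 < y ∧ y < q.2 → P q.1 y) (imp (and ?_ ?_) ?_)))).congr
    fun x => ?_
  · exact lt hL .fst .snd
  · exact lt hL (.fst' .fst) .snd
  · exact lt hL .snd (.snd' .fst)
  · exact comp₂ h (.fst' .fst) .snd
  · exact mem_nhdsGT_iff_exists_Ioo_subset

theorem DefinablePred.eventually_nhdsLT (hL : IsOMinimalExpansion L) {P : ℝ → ℝ → Prop}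
    (h : DefinablePred L fun q : ℝ × ℝ => P q.1 q.2) :
    DefinablePred L fun x => ∀ᶠ y in 𝓝[<] x, P x y := by
  refine (ex (P := fun x b => b < x ∧ ∀ y, b < y ∧ y < x → P x y) (and ?_
    (all (P := fun (q : ℝ × ℝ) y => q.2 < y ∧ y < q.1 → P q.1 y) (imp (and ?_ ?_) ?_)))).congr
    fun x => ?_
  · exact lt hL .snd .fst
  · exact lt hL (.snd' .fst) .snd
  · exact lt hL .snd (.fst' .fst)
  · exact comp₂ h (.fst' .fst) .snd
  · exact mem_nhdsLT_iff_exists_Ioo_subset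

namespace IsOMinimalExpansion

/-- Either one of the finitely many pieces eventually contains the filter, or each piece, hence
their union, is eventually avoided. -/
theorem eventually_or_of_filter (hL : IsOMinimalExpansion L)
    {P : ℝ → Prop} (hP : DefinablePred L P) {l : Filter ℝ}
    (hl : ∀ J : Set ℝ, J.OrdConnected → (∀ᶠ x in l, x ∈ J) ∨ ∀ᶠ x in l, x ∉ J) :
    (∀ᶠ x in l, P x) ∨ ∀ᶠ x in l, ¬ P x := by
  have hP' : (Set.univ : Set ℝ).Definable₁ L {x | P x} :=
    hP.reindex (fun v : Fin 1 → ℝ => v 0) (fun _ => (0 : Fin 1)) fun _ _ => rfl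
  obtain ⟨I, hfin, hI, hS⟩ := hL.finite_union _ hP'
  have hmem : ∀ x, P x ↔ ∃ J ∈ I, x ∈ J := fun x => by
    rw [← Set.mem_sUnion, ← hS]
    rfl
  have hord : ∀ J ∈ I, J.OrdConnected := fun J hJ => by
    rcases hI J hJ with ⟨a, rfl⟩ | ⟨a, b, rfl⟩
    · exact Set.ordConnected_singleton
    · refine ⟨fun x hx y hy z hz => ⟨hx.1.trans_le ?_, lt_of_le_of_lt ?_ hy.2⟩⟩
      · exact_mod_cast hz.1
      · exact_mod_cast hz.2
  by_cases h : ∃ J ∈ I, ∀ᶠ x in l, x ∈ J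
  · obtain ⟨J, hJ, h⟩ := h
    exact Or.inl (h.mono fun x hx => (hmem x).2 ⟨J, hJ, hx⟩)
  · simp only [not_exists, not_and] at h
    refine Or.inr (((eventually_all_finite hfin).2 fun J hJ =>
      (hl J (hord J hJ)).resolve_left (h J hJ)).mono fun x hx hPx => ?_)
    obtain ⟨J, hJ, hxJ⟩ := (hmem x).1 hPx
    exact hx J hJ hxJ

theorem eventually_nhdsGT_or (hL : IsOMinimalExpansion L)
    {P : ℝ → Prop} (hP : DefinablePred L P) (a : ℝ) :
    (∀ᶠ x in 𝓝[>] a, P x) ∨ ∀ᶠ x in 𝓝[>] a, ¬ P x :=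
  hL.eventually_or_of_filter hP fun _ hJ => hJ.eventually_nhdsGT_or a

theorem eventually_nhdsLT_or (hL : IsOMinimalExpansion L)
    {P : ℝ → Prop} (hP : DefinablePred L P) (a : ℝ) :
    (∀ᶠ x in 𝓝[<] a, P x) ∨ ∀ᶠ x in 𝓝[<] a, ¬ P x :=
  hL.eventually_or_of_filter hP fun _ hJ => hJ.eventually_nhdsLT_or a

variable {f : ℝ → ℝ}

/-- Trichotomy for germs of definable functions. -/
theorem eventually_lt_or_eq_or_gt (hL : IsOMinimalExpansion L)
    (hf : DefinableMap L f) (c : ℝ) {l : Filter ℝ}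
    (hl : ∀ P : ℝ → Prop, DefinablePred L P → (∀ᶠ x in l, P x) ∨ ∀ᶠ x in l, ¬ P x) :
    (∀ᶠ x in l, c < f x) ∨ (∀ᶠ x in l, f x = c) ∨ ∀ᶠ x in l, f x < c := by
  rcases hl _ (DefinablePred.lt hL (.const c) hf) with h | h
  · exact Or.inl h
  rcases hl _ (DefinablePred.lt hL hf (.const c)) with h' | h'
  · exact Or.inr (Or.inr h')
  · exact Or.inr (Or.inl ((h.and h').mono fun x hx => le_antisymm (not_lt.1 hx.1) (not_lt.1 hx.2)))

/-- The monotonicity theorem, for germs at `0` from the right. -/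
theorem exists_monotoneOn_or_antitoneOn (hL : IsOMinimalExpansion L) (hf : DefinableMap L f) :
    ∃ δ > 0, MonotoneOn f (Set.Ioo 0 δ) ∨ AntitoneOn f (Set.Ioo 0 δ) := by
  have h1 : DefinableMap L fun q : ℝ × ℝ => f q.1 := hf.comp .fst
  have h2 : DefinableMap L fun q : ℝ × ℝ => f q.2 := hf.comp .snd
  have key : ∀ {P Q R : ℝ → Prop}, DefinablePred L P → DefinablePred L Q →
      (∀ x, P x ∨ Q x ∨ R x) →
      (∀ᶠ x in 𝓝[>] 0, P x) ∨ (∀ᶠ x in 𝓝[>] 0, Q x) ∨ ∀ᶠ x in 𝓝[>] 0, R x := by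
    intro P Q R hP hQ h
    rcases hL.eventually_nhdsGT_or hP 0 with h' | h'
    · exact Or.inl h'
    rcases hL.eventually_nhdsGT_or hQ 0 with h'' | h''
    · exact Or.inr (Or.inl h'')
    · refine Or.inr (Or.inr ((h'.and h'').mono fun x hx => ?_))
      exact ((h x).resolve_left hx.1).resolve_left hx.2
  have hr := key (DefinablePred.eventually_nhdsGT hL (P := fun x y => f x < f y) (.lt hL h1 h2))
    (DefinablePred.eventually_nhdsGT hL (P := fun x y => f y = f x) (.eq h2 h1))
    fun x => hL.eventually_lt_or_eq_or_gt hf (f x) fun P hP => hL.eventually_nhdsGT_or hP x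
  have hl := key (DefinablePred.eventually_nhdsLT hL (P := fun x y => f x < f y) (.lt hL h1 h2))
    (DefinablePred.eventually_nhdsLT hL (P := fun x y => f y = f x) (.eq h2 h1))
    fun x => hL.eventually_lt_or_eq_or_gt hf (f x) fun P hP => hL.eventually_nhdsLT_or hP x
  have hmono : ((∀ᶠ x in 𝓝[>] 0, ∀ᶠ y in 𝓝[>] x, f x ≤ f y) ∧
      ∀ᶠ x in 𝓝[>] 0, ∀ᶠ y in 𝓝[<] x, f y ≤ f x) →
      ∃ δ > 0, MonotoneOn f (Set.Ioo 0 δ) ∨ AntitoneOn f (Set.Ioo 0 δ) := by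
    rintro ⟨h, h'⟩
    obtain ⟨δ, hδ, hI⟩ := mem_nhdsGT_iff_exists_Ioo_subset.1 (h.and h')
    exact ⟨δ, hδ, Or.inl (monotoneOn_Ioo_of_eventually (fun x hx => (hI hx).1)
      fun x hx => (hI hx).2)⟩
  have hanti : ((∀ᶠ x in 𝓝[>] 0, ∀ᶠ y in 𝓝[>] x, f y ≤ f x) ∧
      ∀ᶠ x in 𝓝[>] 0, ∀ᶠ y in 𝓝[<] x, f x ≤ f y) →
      ∃ δ > 0, MonotoneOn f (Set.Ioo 0 δ) ∨ AntitoneOn f (Set.Ioo 0 δ) := by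
    rintro ⟨h, h'⟩
    obtain ⟨δ, hδ, hI⟩ := mem_nhdsGT_iff_exists_Ioo_subset.1 (h.and h')
    have := monotoneOn_Ioo_of_eventually (f := fun x => - f x)
      (fun x hx => (hI hx).1.mono fun y hy => neg_le_neg hy)
      fun x hx => (hI hx).2.mono fun y hy => neg_le_neg hy
    exact ⟨δ, hδ, Or.inr fun x hx y hy hxy => neg_le_neg_iff.1 (this hx hy hxy)⟩
  have hmin : ∀ g : ℝ → ℝ, ¬ ∀ᶠ x in 𝓝[>] 0, (∀ᶠ y in 𝓝[>] x, g x < g y) ∧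
      ∀ᶠ y in 𝓝[<] x, g x < g y := by
    intro g h
    obtain ⟨δ, hδ, hI⟩ := mem_nhdsGT_iff_exists_Ioo_subset.1 h
    exact absurd ((countable_setOf_strict_local_min g).mono hI)
      fun h => not_le.2 (Set.mem_Ioi.1 hδ) (Cardinal.Real.Ioo_countable_iff.1 h)
  -- Near `0` the behaviour to the right and to the left of `x` does not depend on `x`. Of the nine
  -- combinations, two are a strict local minimum or maximum everywhere, which countability forbids;
  -- the other seven give monotonicity.
  rcases hr with hr | hr | hr <;> rcases hl with hl | hl | hl
  · exact absurd (hr.and hl) (hmin f)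
  · exact hmono ⟨hr.mono fun x h => h.mono fun y h => h.le,
      hl.mono fun x h => h.mono fun y h => h.le⟩
  · exact hmono ⟨hr.mono fun x h => h.mono fun y h => h.le,
      hl.mono fun x h => h.mono fun y h => h.le⟩
  · exact hanti ⟨hr.mono fun x h => h.mono fun y h => h.le,
      hl.mono fun x h => h.mono fun y h => h.le⟩
  · exact hmono ⟨hr.mono fun x h => h.mono fun y h => h.ge,
      hl.mono fun x h => h.mono fun y h => h.le⟩
  · exact hmono ⟨hr.mono fun x h => h.mono fun y h => h.ge,
      hl.mono fun x h => h.mono fun y h => h.le⟩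
  · exact hanti ⟨hr.mono fun x h => h.mono fun y h => h.le,
      hl.mono fun x h => h.mono fun y h => h.le⟩
  · exact hanti ⟨hr.mono fun x h => h.mono fun y h => h.le,
      hl.mono fun x h => h.mono fun y h => h.ge⟩
  · exact absurd ((hr.and hl).mono fun x h => And.intro
      (h.1.mono fun y h => neg_lt_neg h) (h.2.mono fun y h => neg_lt_neg h)) (hmin fun x => - f x)

/-- By Lebesgue's theorem for monotone functions; this weak form of smoothness suffices below. -/
theorem eventually_ae_differentiableAt (hL : IsOMinimalExpansion L) (hf : DefinableMap L f) :
    ∀ᶠ δ in 𝓝[>] (0 : ℝ), ∀ᵐ t, t ∈ Set.Ioo 0 δ → DifferentiableAt ℝ f t := by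
  obtain ⟨δ, hδ, h⟩ := hL.exists_monotoneOn_or_antitoneOn hf
  have hd : ∀ᵐ t, t ∈ Set.Ioo 0 δ → DifferentiableWithinAt ℝ f (Set.Ioo 0 δ) t := by
    rcases h with h | h
    · exact h.ae_differentiableWithinAt_of_mem
    · filter_upwards [h.neg.ae_differentiableWithinAt_of_mem] with t ht htI
      simpa using (ht htI).neg
  filter_upwards [Ioo_mem_nhdsGT hδ] with δ' hδ'
  filter_upwards [hd] with t ht htI
  have htI' : t ∈ Set.Ioo 0 δ := ⟨htI.1, htI.2.trans hδ'.2⟩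
  exact (ht htI').differentiableAt (Ioo_mem_nhds htI'.1 htI'.2)

theorem exists_tendsto_nhdsGT_zero (hL : IsOMinimalExpansion L) (hf : DefinableMap L f) {C : ℝ}
    (hC : ∀ᶠ t in 𝓝[>] (0 : ℝ), |f t| ≤ C) : ∃ ℓ, Tendsto f (𝓝[>] 0) (𝓝 ℓ) := by
  obtain ⟨δ, hδ, h⟩ := hL.exists_monotoneOn_or_antitoneOn hf
  obtain ⟨δ', hδ', hI⟩ := mem_nhdsGT_iff_exists_Ioo_subset.1 hC
  have hm : 0 < min δ δ' := lt_min hδ hδ'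
  have hsub : Set.Ioo 0 (min δ δ') ⊆ Set.Ioo 0 δ := Set.Ioo_subset_Ioo_right (min_le_left _ _)
  have hb : ∀ t ∈ Set.Ioo 0 (min δ δ'), |f t| ≤ C := fun t ht =>
    hI ⟨ht.1, ht.2.trans_le (min_le_right _ _)⟩
  rcases h with h | h
  · refine ⟨_, (h.mono hsub).tendsto_nhdsWithin_Ioo_right (Set.nonempty_Ioo.2 hm) ⟨-C, ?_⟩⟩
    rintro _ ⟨t, ht, rfl⟩
    exact (abs_le.1 (hb t ht)).1
  · refine ⟨_, (h.mono hsub).tendsto_nhdsWithin_Ioo_right (Set.nonempty_Ioo.2 hm) ⟨C, ?_⟩⟩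
    rintro _ ⟨t, ht, rfl⟩
    exact (abs_le.1 (hb t ht)).2

end IsOMinimalExpansion

end OMinimal

/-! ### Polynomial boundedness and the estimate `t f' = O(f)` -/

section PolynomiallyBounded

variable {L : FirstOrder.Language} [L.Structure ℝ]

/-- Apply the growth bound at infinity to `s ↦ 1 / f (1 / s)`. -/
theorem IsPolynomiallyBounded.eventually_pow_le (hL : IsOMinimalExpansion L)
    (hpb : IsPolynomiallyBounded L) {f : ℝ → ℝ} (hf : DefinableMap L f)
    (hpos : ∀ᶠ t in 𝓝[>] (0 : ℝ), 0 < f t) : ∃ N : ℕ, ∀ᶠ t in 𝓝[>] (0 : ℝ), t ^ N ≤ f t := by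
  have hg : DefinableMap L fun s : ℝ => (f s⁻¹)⁻¹ := (hf.comp (.inv hL .id)).inv hL
  obtain ⟨N, hN⟩ := hpb (fun s => (f s⁻¹)⁻¹) (DefinablePred.reindex
    (hg.congr fun _ => eq_comm : DefinablePred L fun p : ℝ × ℝ => p.2 = (f p.1⁻¹)⁻¹)
    (fun v : Fin 2 → ℝ => (v 0, v 1)) (Sum.elim (fun _ => (0 : Fin 2)) fun _ => (1 : Fin 2))
    (by rintro p (i | i) <;> rfl))
  refine ⟨N, ?_⟩
  filter_upwards [tendsto_inv_nhdsGT_zero.eventually hN, hpos, self_mem_nhdsWithin] with t ht hft h0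
  rw [inv_inv, abs_of_pos (inv_pos.2 hft), inv_pow] at ht
  exact (inv_le_inv₀ hft (pow_pos h0 N)).1 ht

/-- A positive monotone germ with limit `0` is nondecreasing, so `f' ≥ 0`. If `t ^ N ≤ f`, then `f /
t ^ (N + 1) ≥ 1 / t` blows up; being a monotone germ it is nonincreasing, and the sign of its
derivative says `t f' ≤ (N + 1) f`. The exponent `N + 1` rather than `N` is what forces the blow-up.
-/
theorem IsPolynomiallyBounded.exists_mul_deriv_le_of_pos (hL : IsOMinimalExpansion L)
    (hpb : IsPolynomiallyBounded L) {f : ℝ → ℝ} (hf : DefinableMap L f)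
    (hpos : ∀ᶠ t in 𝓝[>] (0 : ℝ), 0 < f t) (h0 : Tendsto f (𝓝[>] 0) (𝓝 0)) :
    ∃ C, ∀ᶠ t in 𝓝[>] (0 : ℝ), ∀ f', HasDerivAt f f' t → |t * f'| ≤ C * |f t| := by
  obtain ⟨N, hN⟩ := hpb.eventually_pow_le hL hf hpos
  have hg : DefinableMap L fun t => f t * (t ^ (N + 1))⁻¹ :=
    hf.mul hL ((DefinableMap.id.pow hL _).inv hL)
  obtain ⟨δ, hδ, hm⟩ := hL.exists_monotoneOn_or_antitoneOn hf
  obtain ⟨ε, hε, hgm⟩ := hL.exists_monotoneOn_or_antitoneOn hg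
  -- The wrong direction of monotonicity leads to `False` eventually, which is discarded below
  -- because the filter is nontrivial.
  have hmono : MonotoneOn f (Set.Ioo 0 δ) ∨ ∀ᶠ t in 𝓝[>] (0 : ℝ), False := by
    refine hm.imp id fun hm => ?_
    obtain ⟨t, ht, htδ⟩ := (hpos.and (Ioo_mem_nhdsGT hδ)).exists
    filter_upwards [h0.eventually (gt_mem_nhds ht), Ioo_mem_nhdsGT htδ.1] with s hs hst
    exact absurd (hm ⟨hst.1, hst.2.trans htδ.2⟩ htδ hst.2.le) (not_le.2 hs)
  have hanti : AntitoneOn (fun t => f t * (t ^ (N + 1))⁻¹) (Set.Ioo 0 ε) ∨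
      ∀ᶠ t in 𝓝[>] (0 : ℝ), False := by
    refine hgm.symm.imp id fun hm => ?_
    have hε2 : ε / 2 ∈ Set.Ioo 0 ε := ⟨half_pos hε, half_lt_self hε⟩
    filter_upwards [hN, Ioo_mem_nhdsGT hε2.1,
      tendsto_inv_nhdsGT_zero.eventually (eventually_gt_atTop (f (ε / 2) * ((ε / 2) ^ (N + 1))⁻¹))]
      with t ht htε hlarge
    refine absurd (hm ⟨htε.1, htε.2.trans hε2.2⟩ hε2 htε.2.le) (not_le.2 (hlarge.trans_le ?_))
    change t⁻¹ ≤ f t * (t ^ (N + 1))⁻¹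
    rw [← div_eq_mul_inv, le_div_iff₀ (pow_pos htε.1 _), pow_succ', ← mul_assoc,
      inv_mul_cancel₀ htε.1.ne', one_mul]
    exact ht
  simp only [eventually_false_iff_eq_bot, (nhdsGT_neBot (0 : ℝ)).ne, or_false] at hmono hanti
  refine ⟨N + 1, ?_⟩
  filter_upwards [hpos, Ioo_mem_nhdsGT hδ, Ioo_mem_nhdsGT hε] with t hft htδ htε f' hf'
  have hnonneg : 0 ≤ f' := by
    have := hmono.derivWithin_nonneg (x := t)
    rwa [derivWithin_of_mem_nhds (Ioo_mem_nhds htδ.1 htδ.2), hf'.deriv] at this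
  have ht0 : t ≠ 0 := htδ.1.ne'
  have hle : f' * (t ^ (N + 1))⁻¹ + f t * (-((N + 1 : ℕ) * t ^ N) / (t ^ (N + 1)) ^ 2) ≤ 0 := by
    have := hanti.derivWithin_nonpos (x := t)
    rwa [derivWithin_of_mem_nhds (Ioo_mem_nhds htε.1 htε.2),
      (hf'.fun_mul ((hasDerivAt_pow (N + 1) t).fun_inv (pow_ne_zero _ ht0))).deriv] at this
  have hbound : t * f' ≤ (N + 1) * f t := by
    have h2 : f' * (t ^ (N + 1))⁻¹ + f t * (-((N + 1 : ℕ) * t ^ N) / (t ^ (N + 1)) ^ 2) =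
        (t * f' - (N + 1) * f t) / t ^ (N + 2) := by
      push_cast
      field_simp
      ring
    rw [h2, div_nonpos_iff] at hle
    have := pow_pos htδ.1 (N + 2)
    rcases hle with h | h
    · linarith
    · linarith
  rw [abs_of_nonneg (mul_nonneg htδ.1.le hnonneg), abs_of_pos hft]
  exact hbound

/-- A definable germ `f` tending to `0` satisfies `t * deriv f t = O(f t)`. -/
theorem IsPolynomiallyBounded.exists_mul_deriv_le (hL : IsOMinimalExpansion L)
    (hpb : IsPolynomiallyBounded L) {f : ℝ → ℝ} (hf : DefinableMap L f)
    (h0 : Tendsto f (𝓝[>] 0) (𝓝 0)) :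
    ∃ C, ∀ᶠ t in 𝓝[>] (0 : ℝ), ∀ f', HasDerivAt f f' t → |t * f'| ≤ C * |f t| := by
  rcases hL.eventually_lt_or_eq_or_gt hf 0 fun P hP => hL.eventually_nhdsGT_or hP 0 with h | h | h
  · exact hpb.exists_mul_deriv_le_of_pos hL hf h h0
  · refine ⟨0, ?_⟩
    obtain ⟨δ, hδ, hI⟩ := mem_nhdsGT_iff_exists_Ioo_subset.1 h
    filter_upwards [Ioo_mem_nhdsGT hδ] with t ht f' hf'
    have : f =ᶠ[𝓝 t] fun _ => 0 := by
      filter_upwards [Ioo_mem_nhds ht.1 ht.2] with s hs using hI hs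
    rw [hf'.unique ((hasDerivAt_const t (0 : ℝ)).congr_of_eventuallyEq this)]
    simp
  · obtain ⟨C, hC⟩ := hpb.exists_mul_deriv_le_of_pos hL (hf.neg hL)
      (h.mono fun t ht => neg_pos.2 ht) (by simpa using h0.neg)
    refine ⟨C, hC.mono fun t ht f' hf' => ?_⟩
    simpa using ht _ hf'.neg

end PolynomiallyBounded

/-! ### Definable choice -/

section Choice

variable {L : FirstOrder.Language} [L.Structure ℝ]
variable {E : Type} [RealCoordinates E]

theorem DefinablePred.isGLB (hL : IsOMinimalExpansion L)
    {S : E → ℝ → Prop} (h : DefinablePred L fun q : E × ℝ => S q.1 q.2) :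
    DefinablePred L fun q : E × ℝ => IsGLB {x | S q.1 x} q.2 := by
  have hlb : DefinablePred L fun q : E × ℝ => ∀ x, S q.1 x → q.2 ≤ x :=
    all (P := fun (q : E × ℝ) x => S q.1 x → q.2 ≤ x)
      (imp (comp₂ h (.fst' .fst) .snd) (le hL (.snd' .fst) .snd))
  refine (hlb.and (all (P := fun (q : E × ℝ) b => (∀ x, S q.1 x → b ≤ x) → b ≤ q.2)
    (imp (comp₂ (P := fun p b => ∀ x, S p x → b ≤ x) hlb (.fst' .fst) .snd)
      (le hL .snd (.snd' .fst))))).congr fun q => Iff.rfl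

theorem DefinablePred.isLUB (hL : IsOMinimalExpansion L)
    {S : E → ℝ → Prop} (h : DefinablePred L fun q : E × ℝ => S q.1 q.2) :
    DefinablePred L fun q : E × ℝ => IsLUB {x | S q.1 x} q.2 := by
  have hub : DefinablePred L fun q : E × ℝ => ∀ x, S q.1 x → x ≤ q.2 :=
    all (P := fun (q : E × ℝ) x => S q.1 x → x ≤ q.2)
      (imp (comp₂ h (.fst' .fst) .snd) (le hL .snd (.snd' .fst)))
  refine (hub.and (all (P := fun (q : E × ℝ) b => (∀ x, S q.1 x → x ≤ b) → q.2 ≤ b)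
    (imp (comp₂ (P := fun p b => ∀ x, S p x → x ≤ b) hub (.fst' .fst) .snd)
      (le hL (.snd' .fst) .snd)))).congr fun q => Iff.rfl

/-- Definable choice in a family of subsets of the line that are bounded below: the least element
if there is one, else the midpoint of the leftmost interval, cut off at length one. -/
theorem exists_definable_choice_real (hL : IsOMinimalExpansion L) {S : E → ℝ → Prop}
    (h : DefinablePred L fun q : E × ℝ => S q.1 q.2) (hbdd : ∀ p, BddBelow {x | S p x}) :
    ∃ c : E → ℝ, DefinableMap L c ∧ ∀ p, (∃ x, S p x) → S p (c p) := by
  -- With `q.2` the infimum of the fibre, `sSup` of `T` is the right end of the leftmost interval of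
  -- the fibre, truncated at length one.
  let T : E × ℝ → ℝ → Prop := fun q b => b ≤ q.2 + 1 ∧ ∀ x, q.2 < x → x < b → S q.1 x
  have hT : DefinablePred L fun q : (E × ℝ) × ℝ => T q.1 q.2 := by
    refine .and (.le hL .snd (.add hL (.snd' .fst) (.const 1)))
      (.all (P := fun (q : (E × ℝ) × ℝ) x => q.1.2 < x → x < q.2 → S q.1.1 x)
        (.imp (.lt hL (.snd' (.fst' .fst)) .snd) (.imp (.lt hL .snd (.snd' .fst)) ?_)))
    exact .comp₂ h (.fst' (.fst' .fst)) .snd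
  let a : E → ℝ := fun p => sInf {x | S p x}
  let b : E → ℝ := fun p => sSup {x | T (p, a p) x}
  have hne : ∀ p, {x | T (p, a p) x}.Nonempty := fun p =>
    ⟨a p, by linarith, fun x h1 h2 => absurd (h1.trans h2) (lt_irrefl _)⟩
  have hbd : ∀ p, BddAbove {x | T (p, a p) x} := fun p => ⟨a p + 1, fun x hx => hx.1⟩
  have ha : DefinableMap L a := by
    -- An empty fibre has no greatest lower bound in `ℝ`, and `sInf ∅ = 0`; the second disjunct
    -- describes this case.
    refine ((DefinablePred.isGLB hL h).or ((DefinablePred.ex (F := ℝ)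
      (P := fun (q : E × ℝ) x => S q.1 x) (.comp₂ h (.fst' .fst) .snd)).not.and
        (.eq .snd (.const (0 : ℝ))))).congr fun q => ?_
    by_cases hx : ∃ x, S q.1 x
    · have := isGLB_csInf (s := {x | S q.1 x}) hx (hbdd q.1)
      simp only [hx, not_true_eq_false, false_and, or_false]
      exact ⟨fun e => e ▸ this, fun e => this.unique e⟩
    · have hemp : {x | S q.1 x} = ∅ := Set.eq_empty_iff_forall_notMem.2 fun x h => hx ⟨x, h⟩
      simp [a, hx, hemp, eq_comm, isGLB_empty_iff]
  have hb : DefinableMap L b := by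
    refine ((DefinablePred.isLUB hL hT).comp₂ (P := fun (q : E × ℝ) c => IsLUB {x | T q x} c)
      (.prodMk .fst (.comp ha .fst)) .snd).congr fun q => ?_
    have := isLUB_csSup (hne q.1) (hbd q.1)
    exact ⟨fun e => e ▸ this, fun e => this.unique e⟩
  have hSa : DefinablePred L fun q : E × ℝ => S q.1 (a q.1) := .comp₂ h .fst (.comp ha .fst)
  classical
  refine ⟨fun p => if S p (a p) then a p else (a p + b p) * 2⁻¹, ?_, fun p hp => ?_⟩
  · refine ((hSa.and (.eq (.comp ha .fst) .snd)).or (hSa.not.and (.eq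
      (.mul hL (.add hL (.comp ha .fst) (.comp hb .fst)) (.const 2⁻¹)) .snd))).congr fun q => ?_
    by_cases hq : S q.1 (a q.1) <;> simp [hq]
  · dsimp only
    split_ifs with hpa
    · exact hpa
    have hglb := isGLB_csInf (s := {x | S p x}) hp (hbdd p)
    -- The infimum is not attained, so the fibre accumulates at it from the right; by o-minimality
    -- it contains an interval there.
    have hab : a p < b p := by
      rcases hL.eventually_nhdsGT_or (P := S p) (.comp₂ h (.const p) .id) (a p) with hev | hev
      · obtain ⟨d, hd, hdI⟩ := mem_nhdsGT_iff_exists_Ioo_subset.1 hev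
        refine (lt_min hd (lt_add_one (a p))).trans_le (le_csSup (hbd p) ⟨min_le_right _ _, ?_⟩)
        exact fun x h1 h2 => hdI ⟨h1, h2.trans_le (min_le_left _ _)⟩
      · obtain ⟨d, hd, hdI⟩ := mem_nhdsGT_iff_exists_Ioo_subset.1 hev
        obtain ⟨x, hx, hxd⟩ := (isGLB_lt_iff hglb).1 hd
        rcases (hglb.1 hx).eq_or_lt with e | hlt
        · refine absurd ?_ hpa
          change S p (sInf {x | S p x})
          rwa [e]
        · exact absurd hx (hdI ⟨hlt, hxd⟩)
    obtain ⟨d, hd, hlt⟩ := exists_lt_of_lt_csSup (hne p)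
      (show (a p + b p) * 2⁻¹ < sSup {x | T (p, a p) x} by change _ < b p; linarith)
    exact hd.2 _ (by change a p < _; linarith) hlt

/-- Choose the first coordinate in the projection of the fibre, then the others by induction in the
slice above it. -/
theorem exists_definable_choice_pi (hL : IsOMinimalExpansion L) (n : ℕ) {S : E → (Fin n → ℝ) → Prop}
    (h : DefinablePred L fun q : E × (Fin n → ℝ) => S q.1 q.2)
    (hbdd : ∀ p, ∃ B : ℝ, ∀ w, S p w → ∀ i, B ≤ w i) :
    ∃ c : E → Fin n → ℝ, DefinableMap L c ∧ ∀ p, (∃ w, S p w) → S p (c p) := by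
  induction n with
  | zero =>
    refine ⟨fun _ => 0, .const _, fun p ⟨w, hw⟩ => ?_⟩
    rwa [Subsingleton.elim (0 : Fin 0 → ℝ) w]
  | succ n ih =>
    have hcons : ∀ {F : Type} [RealCoordinates F] {f : F → ℝ} {g : F → Fin n → ℝ},
        DefinableMap L f → DefinableMap L g →
        DefinableMap L fun q => (Fin.cons (f q) (g q) : Fin (n + 1) → ℝ) := by
      intro F _ f g hf hg
      refine .of_coords fun i : Fin (n + 1) => ?_
      refine Fin.cases ?_ (fun j => ?_) i
      · exact hf
      · exact DefinableMap.comp (g := fun w : Fin n → ℝ => w j)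
          (DefinablePred.map_eq_of_coords (fun _ => j) fun _ _ => rfl) hg
    obtain ⟨c₁, hc₁, hS₁⟩ := exists_definable_choice_real hL
      (S := fun p a => ∃ w : Fin n → ℝ, S p (Fin.cons a w))
      (.ex (P := fun (q : E × ℝ) w => S q.1 (Fin.cons q.2 w))
        (.comp₂ h (.fst' .fst) (hcons (.snd' .fst) .snd)))
      fun p => by
        obtain ⟨B, hB⟩ := hbdd p
        exact ⟨B, fun a ⟨w, hw⟩ => by simpa using hB _ hw 0⟩
    obtain ⟨c₂, hc₂, hS₂⟩ := ih (S := fun p w => S p (Fin.cons (c₁ p) w))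
      (.comp₂ h .fst (hcons (.comp hc₁ .fst) .snd))
      fun p => by
        obtain ⟨B, hB⟩ := hbdd p
        exact ⟨B, fun w hw i => by simpa using hB _ hw i.succ⟩
    refine ⟨fun p => Fin.cons (c₁ p) (c₂ p), hcons hc₁ hc₂, fun p ⟨w, hw⟩ => hS₂ p (hS₁ p ?_)⟩
    exact ⟨w 0, Fin.tail w, by rwa [Fin.cons_self_tail]⟩

/-- Definable choice in a family of bounded subsets of Euclidean space. -/
theorem exists_definable_choice (hL : IsOMinimalExpansion L)
    {n : ℕ} {S : E → EuclideanSpace ℝ (Fin n) → Prop}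
    (h : DefinablePred L fun q : E × EuclideanSpace ℝ (Fin n) => S q.1 q.2)
    (hbdd : ∀ p, ∃ B : ℝ, ∀ y, S p y → ‖y‖ ≤ B) :
    ∃ c : E → EuclideanSpace ℝ (Fin n), DefinableMap L c ∧ ∀ p, (∃ y, S p y) → S p (c p) := by
  have hLp : DefinableMap L fun w : Fin n → ℝ => (WithLp.toLp 2 w : EuclideanSpace ℝ (Fin n)) :=
    DefinablePred.map_eq_of_coords (fun i => i) fun _ _ => rfl
  obtain ⟨c, hc, hS⟩ := exists_definable_choice_pi hL n (S := fun p w => S p (WithLp.toLp 2 w))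
    (.comp₂ h .fst (.comp hLp .snd)) fun p => by
      obtain ⟨B, hB⟩ := hbdd p
      refine ⟨-B, fun w hw i => ?_⟩
      have := (PiLp.norm_apply_le (WithLp.toLp 2 w : EuclideanSpace ℝ (Fin n)) i).trans (hB _ hw)
      exact (abs_le.1 this).1
  exact ⟨fun p => WithLp.toLp 2 (c p), hLp.comp hc, fun p ⟨y, hy⟩ => hS p ⟨WithLp.ofLp y, hy⟩⟩

end Choice

/-! ### Tangent and normal spaces of submanifolds -/

section Submanifold

open Asymptotics

variable {n d : ℕ}

local notation "𝔼" => EuclideanSpace ℝ (Fin n)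

/-- `u` is normal to `M` at `y`: the distance of a point `z` of `M` from the hyperplane
through `y` orthogonal to `u` is `o(|z - y|)`. -/
def IsNormalAt (M : Set 𝔼) (y u : 𝔼) : Prop :=
  (fun z : 𝔼 => inner ℝ u (z - y)) =o[𝓝[M] y] fun z => z - y

/-- Here the quantifiers range over points and numbers only, so the condition is definable; the
definition of the tangent space quantifies over curves. -/
theorem isNormalAt_iff {M : Set 𝔼} {y u : 𝔼} : IsNormalAt M y u ↔
    ∀ ε : ℝ, 0 < ε → ∃ δ : ℝ, 0 < δ ∧
      ∀ z : 𝔼, ‖z - y‖ < δ → z ∈ M →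
        inner ℝ u (z - y) ≤ ε * ‖z - y‖ ∧ -(ε * ‖z - y‖) ≤ inner ℝ u (z - y) := by
  simp only [IsNormalAt, isLittleO_iff, eventually_nhdsWithin_iff, Metric.eventually_nhds_iff,
    dist_eq_norm, Real.norm_eq_abs, abs_le, gt_iff_lt, and_comm]

theorem inner_eq_zero_of_isNormalAt {M : Set 𝔼} {y u v : 𝔼} (hu : IsNormalAt M y u)
    {γ : ℝ → 𝔼} (h0 : γ 0 = y) (hM : ∀ᶠ t in 𝓝 (0 : ℝ), γ t ∈ M) (hγ : HasDerivAt γ v 0) :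
    inner ℝ u v = 0 := by
  have h1 : HasDerivAt (fun t => inner ℝ u (γ t)) (inner ℝ u v) 0 := by
    simpa using (hasDerivAt_const (0 : ℝ) u).inner ℝ hγ
  have ht : Tendsto γ (𝓝 0) (𝓝[M] y) :=
    tendsto_nhdsWithin_iff.2 ⟨h0 ▸ hγ.continuousAt.tendsto, hM⟩
  have h2 : HasDerivAt (fun t => inner ℝ u (γ t)) 0 0 := by
    rw [hasDerivAt_iff_isLittleO]
    have := (hu.comp_tendsto ht).trans_isBigO
      (show ((fun z => z - y) ∘ γ) =O[𝓝 0] fun t : ℝ => t - 0 by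
        simpa [Function.comp_def, h0] using hγ.isBigO_sub)
    refine this.congr_left fun t => ?_
    simp [h0, inner_sub_right]
  exact h1.unique h2

theorem mem_submodule_of_hasDerivAt {V : Submodule ℝ 𝔼} {γ : ℝ → 𝔼} {v : 𝔼} {t : ℝ}
    (hγ : HasDerivAt γ v t) (hV : ∀ᶠ s in 𝓝 t, γ s ∈ V) : v ∈ V := by
  rw [← Submodule.orthogonal_orthogonal V, Submodule.mem_orthogonal]
  intro u hu
  have h1 : HasDerivAt (fun t => inner ℝ u (γ t)) (inner ℝ u v) t := by
    simpa using (hasDerivAt_const t u).inner ℝ hγ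
  refine h1.unique ((hasDerivAt_const t (0 : ℝ)).congr_of_eventuallyEq ?_)
  filter_upwards [hV] with s hs
  exact Submodule.inner_left_of_mem_orthogonal hs hu

/-- At each of its points a submanifold `M` has a chart such that the image of the model space
under the derivative of its inverse is the tangent space of `M`. -/
theorem IsC2Submanifold.exists_tangentSpaceAt_eq_map {M : Set 𝔼} (hM : IsC2Submanifold d M)
    {y : 𝔼} (hy : y ∈ M) :
    ∃ (V : Submodule ℝ 𝔼) (A : 𝔼 →L[ℝ] 𝔼) (φ : 𝔼 → 𝔼), Module.finrank ℝ V = d ∧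
      tangentSpaceAt M y = V.map (A : 𝔼 →ₗ[ℝ] 𝔼) ∧
      (∀ᶠ z in 𝓝[M] y, φ z - φ y ∈ V) ∧
      (fun z => z - y - A (φ z - φ y)) =o[𝓝 y] fun z => z - y := by
  obtain ⟨Φ, V, hyΦ, hΦ, hΨ, hV, hiff⟩ := hM y hy
  have hty : Φ y ∈ Φ.target := Φ.map_source hyΦ
  have hΦd : DifferentiableAt ℝ Φ y :=
    (hΦ.contDiffAt (Φ.open_source.mem_nhds hyΦ)).differentiableAt (by norm_num)
  have hΨd : HasFDerivAt Φ.symm (fderiv ℝ Φ.symm (Φ y)) (Φ y) :=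
    ((hΨ.contDiffAt (Φ.open_target.mem_nhds hty)).differentiableAt (by norm_num)).hasFDerivAt
  have hyV : Φ y ∈ V := (hiff y hyΦ).1 hy
  refine ⟨V, fderiv ℝ Φ.symm (Φ y), Φ, hV, le_antisymm ?_ ?_, ?_, ?_⟩
  · refine Submodule.span_le.2 ?_
    rintro v ⟨γ, h0, hγM, hγ⟩
    have hsrc : ∀ᶠ t in 𝓝 (0 : ℝ), γ t ∈ Φ.source :=
      hγ.continuousAt.eventually (Φ.open_source.mem_nhds (h0 ▸ hyΦ))
    have hΦγ : HasDerivAt (Φ ∘ γ) (fderiv ℝ Φ y v) 0 :=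
      HasFDerivAt.comp_hasDerivAt (x := (0 : ℝ)) (h0 ▸ hΦd.hasFDerivAt) hγ
    have hmem : fderiv ℝ Φ y v ∈ V := mem_submodule_of_hasDerivAt hΦγ (by
      filter_upwards [hsrc, hγM] with t h1 h2 using (hiff _ h1).1 h2)
    refine ⟨_, hmem, ?_⟩
    have hcomp : HasDerivAt (Φ.symm ∘ (Φ ∘ γ)) (fderiv ℝ Φ.symm (Φ y) (fderiv ℝ Φ y v)) 0 :=
      HasFDerivAt.comp_hasDerivAt (x := (0 : ℝ)) (by simpa [h0] using hΨd) hΦγ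
    refine hcomp.unique (hγ.congr_of_eventuallyEq ?_)
    filter_upwards [hsrc] with t ht using Φ.left_inv ht
  · rintro _ ⟨w, hw, rfl⟩
    refine Submodule.subset_span ⟨fun t => Φ.symm (Φ y + t • w), by simp [Φ.left_inv hyΦ], ?_, ?_⟩
    · have hc : Tendsto (fun t : ℝ => Φ y + t • w) (𝓝 0) (𝓝 (Φ y)) := by
        have : Continuous fun t : ℝ => Φ y + t • w := by fun_prop
        simpa using this.tendsto 0
      filter_upwards [hc.eventually (Φ.open_target.mem_nhds hty)] with t ht
      rw [hiff _ (Φ.map_target ht), Φ.right_inv ht]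
      exact V.add_mem hyV (V.smul_mem _ hw)
    · have hl : HasDerivAt (fun t : ℝ => Φ y + t • w) w 0 := by
        simpa using ((hasDerivAt_id (0 : ℝ)).smul_const w).const_add (Φ y)
      exact HasFDerivAt.comp_hasDerivAt (x := (0 : ℝ)) (by simpa using hΨd) hl
  · filter_upwards [nhdsWithin_le_nhds (Φ.open_source.mem_nhds hyΦ), self_mem_nhdsWithin]
      with z hz hzM
    exact V.sub_mem ((hiff z hz).1 hzM) hyV
  · have := (hΨd.isLittleO.comp_tendsto hΦd.continuousAt.tendsto).trans_isBigO
      hΦd.hasFDerivAt.isBigO_sub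
    refine this.congr' ?_ EventuallyEq.rfl
    filter_upwards [Φ.open_source.mem_nhds hyΦ] with z hz
    simp [Φ.left_inv hz, Φ.left_inv hyΦ]

/-- A normal vector kills velocities by differentiating `⟨u, γ t⟩`. Conversely, in a chart `z - y`
is a tangent vector up to `o(‖z - y‖)`. -/
theorem IsC2Submanifold.isNormalAt_iff_mem_orthogonal {M : Set 𝔼} (hM : IsC2Submanifold d M)
    {y u : 𝔼} (hy : y ∈ M) : IsNormalAt M y u ↔ u ∈ (tangentSpaceAt M y)ᗮ := by
  constructor
  · intro hu
    rw [Submodule.mem_orthogonal']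
    suffices tangentSpaceAt M y ≤ (ℝ ∙ u)ᗮ from fun v hv =>
      Submodule.mem_orthogonal_singleton_iff_inner_right.1 (this hv)
    refine Submodule.span_le.2 ?_
    rintro v ⟨γ, h0, hγM, hγ⟩
    exact Submodule.mem_orthogonal_singleton_iff_inner_right.2
      (inner_eq_zero_of_isNormalAt hu h0 hγM hγ)
  · intro hu
    obtain ⟨V, A, φ, -, hT, hφV, ho⟩ := hM.exists_tangentSpaceAt_eq_map hy
    have h1 : (fun z : 𝔼 => inner ℝ u (z - y - A (φ z - φ y))) =o[𝓝[M] y] fun z => z - y :=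
      (IsBigO.of_bound ‖u‖ (Eventually.of_forall fun z => norm_inner_le_norm _ _)).trans_isLittleO
        (ho.mono nhdsWithin_le_nhds)
    refine h1.congr' ?_ EventuallyEq.rfl
    filter_upwards [hφV] with z hz
    have : inner ℝ u (A (φ z - φ y)) = 0 := by
      refine (Submodule.mem_orthogonal' _ _).1 hu _ ?_
      rw [hT]
      exact ⟨_, hz, rfl⟩
    rw [inner_sub_right, this, sub_zero]

theorem IsC2Submanifold.mem_tangentSpaceAt_iff {M : Set 𝔼} (hM : IsC2Submanifold d M)
    {y v : 𝔼} (hy : y ∈ M) :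
    v ∈ tangentSpaceAt M y ↔ ∀ w, IsNormalAt M y w → inner ℝ w v = 0 := by
  simp only [hM.isNormalAt_iff_mem_orthogonal hy]
  rw [← Submodule.mem_orthogonal, Submodule.orthogonal_orthogonal]

/-- The tangent space of a curve is spanned by each of its nonzero vectors. -/
theorem IsC2Submanifold.exists_eq_smul {M : Set 𝔼} (hM : IsC2Submanifold 1 M) {y v w : 𝔼}
    (hy : y ∈ M) (hv : v ∈ tangentSpaceAt M y) (hw : w ∈ tangentSpaceAt M y) (hw0 : w ≠ 0) :
    ∃ c : ℝ, v = c • w := by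
  obtain ⟨V, A, -, hV, hT, -⟩ := hM.exists_tangentSpaceAt_eq_map hy
  rw [hT] at hv hw
  obtain ⟨v', hv', rfl⟩ := hv
  obtain ⟨w', hw', rfl⟩ := hw
  have hne : (⟨w', hw'⟩ : V) ≠ 0 := fun h => hw0 (by simp [show w' = 0 from congrArg Subtype.val h])
  obtain ⟨c, hc⟩ := (finrank_eq_one_iff_of_nonzero' _ hne).1 hV ⟨v', hv'⟩
  refine ⟨c, ?_⟩
  rw [← map_smul, show v' = c • w' from (congrArg Subtype.val hc).symm]

end Submanifold

/-! ### The nearest point on a curve -/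

section NearestPoint

variable {n : ℕ}

local notation "𝔼" => EuclideanSpace ℝ (Fin n)

/-- Near a point of a regular `C^2` curve, a point has at most one foot on the curve. -/
theorem exists_forall_eq_of_inner_deriv_eq_zero {g : ℝ → 𝔼} {s₀ : ℝ} (hg : ContDiffAt ℝ 2 g s₀)
    (ha : deriv g s₀ ≠ 0) :
    ∃ ε > 0, ∀ (y : 𝔼) (s t : ℝ), ‖y - g s₀‖ < ε → |s - s₀| < ε → |t - s₀| < ε →
      inner ℝ (y - g s) (deriv g s) = 0 → inner ℝ (y - g t) (deriv g t) = 0 → s = t := by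
  set a := deriv g s₀ with ha_def
  have ha' : 0 < ‖a‖ := norm_pos_iff.2 ha
  have hg' : ContDiffAt ℝ 1 (deriv g) s₀ := by
    simpa only [fderiv_apply_one_eq_deriv] using
      (hg.fderiv_right (m := 1) (by norm_num)).clm_apply (contDiffAt_const (c := (1 : ℝ)))
  obtain ⟨K, U, hU, hK⟩ := hg'.exists_lipschitzOnWith
  have hstrict : HasStrictDerivAt g a s₀ := hg.hasStrictDerivAt (by norm_num)
  have h1 : ∀ᶠ p : ℝ × ℝ in 𝓝 (s₀, s₀),
      ‖g p.1 - g p.2 - (p.1 - p.2) • a‖ ≤ ‖a‖ / 4 * ‖p.1 - p.2‖ :=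
    by simpa using (HasStrictFDerivAt.isLittleO hstrict).def (c := ‖a‖ / 4) (by positivity)
  have hK1 : 0 < (K : ℝ) + 1 := by positivity
  have h2 : ∀ᶠ s in 𝓝 s₀, s ∈ U ∧ ‖deriv g s - a‖ < ‖a‖ / 4 ∧
      ‖g s - g s₀‖ < ‖a‖ ^ 2 / 8 / (K + 1) := by
    refine Filter.Eventually.and hU (.and ?_ ?_)
    · simpa [dist_eq_norm] using
        Metric.tendsto_nhds.1 hg'.continuousAt.tendsto (‖a‖ / 4) (by positivity)
    · simpa [dist_eq_norm] using
        Metric.tendsto_nhds.1 hg.continuousAt.tendsto (‖a‖ ^ 2 / 8 / (K + 1)) (by positivity)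
  obtain ⟨ε₁, hε₁, H1⟩ := Metric.eventually_nhds_iff.1 h1
  obtain ⟨ε₂, hε₂, H2⟩ := Metric.eventually_nhds_iff.1 h2
  refine ⟨min (min ε₁ ε₂) (‖a‖ ^ 2 / 8 / (K + 1)), by positivity, fun y s t hy hs ht hs0 ht0 => ?_⟩
  have hs1 : |s - s₀| < ε₁ := hs.trans_le ((min_le_left _ _).trans (min_le_left _ _))
  have hs2 : |s - s₀| < ε₂ := hs.trans_le ((min_le_left _ _).trans (min_le_right _ _))
  have ht1 : |t - s₀| < ε₁ := ht.trans_le ((min_le_left _ _).trans (min_le_left _ _))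
  have ht2 : |t - s₀| < ε₂ := ht.trans_le ((min_le_left _ _).trans (min_le_right _ _))
  have hrem := H1 (y := (s, t)) (by simp [Prod.dist_eq, Real.dist_eq, hs1, ht1])
  obtain ⟨hsU, hsa, hsg⟩ := H2 (y := s) hs2
  obtain ⟨htU, hta, -⟩ := H2 (y := t) ht2
  have hlip : ‖deriv g s - deriv g t‖ ≤ K * |s - t| := by
    simpa [dist_eq_norm, Real.dist_eq] using hK.dist_le_mul s hsU t htU
  have hys : ‖y - g s‖ ≤ ‖a‖ ^ 2 / 4 / (K + 1) := by
    have := norm_sub_le_norm_sub_add_norm_sub y (g s₀) (g s)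
    rw [norm_sub_rev (g s₀)] at this
    have := hy.trans_le (min_le_right _ _)
    have e : ‖a‖ ^ 2 / 4 / (K + 1 : ℝ) = ‖a‖ ^ 2 / 8 / (K + 1) + ‖a‖ ^ 2 / 8 / (K + 1) := by ring
    linarith
  -- Obtained from the difference of the two orthogonality relations. The three terms on the right
  -- are at most `1/4`, `5/16` and `1/4` times `‖a‖² |s - t|`; the sum `13/16` is less than `1`,
  -- which forces `s = t`.
  have hid : (s - t) * inner ℝ a a = inner ℝ (y - g s) (deriv g s - deriv g t)
      - inner ℝ (g s - g t - (s - t) • a) (deriv g t) - (s - t) * inner ℝ a (deriv g t - a) := by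
    simp only [inner_sub_left, inner_sub_right, inner_smul_left, RCLike.conj_to_real] at hs0 ht0 ⊢
    linarith
  have b1 : |inner ℝ (y - g s) (deriv g s - deriv g t)| ≤ ‖a‖ ^ 2 / 4 * |s - t| := by
    refine (abs_real_inner_le_norm _ _).trans ?_
    calc ‖y - g s‖ * ‖deriv g s - deriv g t‖
        ≤ (‖a‖ ^ 2 / 4 / (K + 1)) * ((K + 1) * |s - t|) := by
          gcongr
          exact hlip.trans (by gcongr; linarith)
      _ = _ := by field_simp
  have hnt : ‖deriv g t‖ ≤ 5 / 4 * ‖a‖ := by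
    have := norm_le_norm_add_norm_sub' (deriv g t) a
    linarith
  have b2 : |inner ℝ (g s - g t - (s - t) • a) (deriv g t)| ≤ 5 / 16 * ‖a‖ ^ 2 * |s - t| := by
    refine (abs_real_inner_le_norm _ _).trans ?_
    calc _ ≤ (‖a‖ / 4 * |s - t|) * (5 / 4 * ‖a‖) := by gcongr; exact hrem
      _ = _ := by ring
  have b3 : |(s - t) * inner ℝ a (deriv g t - a)| ≤ ‖a‖ ^ 2 / 4 * |s - t| := by
    rw [abs_mul]
    calc _ ≤ |s - t| * (‖a‖ * (‖a‖ / 4)) := by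
          gcongr
          exact (abs_real_inner_le_norm _ _).trans (by gcongr)
      _ = _ := by ring
  have hfin : |s - t| * ‖a‖ ^ 2 ≤ 13 / 16 * ‖a‖ ^ 2 * |s - t| := by
    calc |s - t| * ‖a‖ ^ 2 = |(s - t) * inner ℝ a a| := by
          rw [abs_mul, real_inner_self_eq_norm_sq, abs_of_nonneg (sq_nonneg ‖a‖)]
      _ ≤ |inner ℝ (y - g s) (deriv g s - deriv g t)|
          + |inner ℝ (g s - g t - (s - t) • a) (deriv g t)|
          + |(s - t) * inner ℝ a (deriv g t - a)| := by
          rw [hid]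
          refine (abs_sub _ _).trans (add_le_add_left (abs_sub _ _) _)
      _ ≤ _ := by linarith
  have : |s - t| ≤ 0 := by
    have := sq_pos_of_pos ha'
    nlinarith [abs_nonneg (s - t)]
  exact sub_eq_zero.1 (abs_nonpos_iff.1 this)

/-- `x` is a point of `X` nearest to `y`. -/
def IsNearestPoint (X : Set 𝔼) (y x : 𝔼) : Prop :=
  x ∈ X ∧ ∀ z ∈ X, dist y x ≤ dist y z

/-- A submanifold is locally closed, so it meets a small closed ball about `x₀` in a compact set.
For `y` within half the radius, points of `X` outside the ball are farther away than `x₀`. -/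
theorem IsC2Submanifold.eventually_exists_isNearestPoint {d : ℕ} {X : Set 𝔼}
    (hX : IsC2Submanifold d X) {x₀ : 𝔼} (h0 : x₀ ∈ X) :
    ∀ᶠ y in 𝓝 x₀, ∃ x, IsNearestPoint X y x := by
  obtain ⟨Φ, V, h0Φ, hΦ, -, -, hiff⟩ := hX x₀ h0
  obtain ⟨r, hr, hrΦ⟩ := Metric.nhds_basis_closedBall.mem_iff.1 (Φ.open_source.mem_nhds h0Φ)
  have hK : IsCompact (X ∩ Metric.closedBall x₀ r) := by
    have hcl : IsClosed (Metric.closedBall x₀ r ∩ Φ ⁻¹' (V : Set 𝔼)) :=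
      (hΦ.continuousOn.mono hrΦ).preimage_isClosed_of_isClosed Metric.isClosed_closedBall
        V.closed_of_finiteDimensional
    have : X ∩ Metric.closedBall x₀ r = Metric.closedBall x₀ r ∩ Φ ⁻¹' (V : Set 𝔼) := by
      ext z
      constructor
      · exact fun h => ⟨h.2, (hiff z (hrΦ h.2)).1 h.1⟩
      · exact fun h => ⟨(hiff z (hrΦ h.1)).2 h.2, h.1⟩
    rw [this]
    exact (isCompact_closedBall x₀ r).of_isClosed_subset hcl Set.inter_subset_left
  filter_upwards [Metric.ball_mem_nhds x₀ (half_pos hr)] with y hy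
  obtain ⟨x, hx, hmin⟩ := hK.exists_isMinOn ⟨x₀, h0, Metric.mem_closedBall_self hr.le⟩
    (continuous_const.dist continuous_id : Continuous fun z => dist y z).continuousOn
  refine ⟨x, hx.1, fun z hz => ?_⟩
  by_cases hzr : z ∈ Metric.closedBall x₀ r
  · exact hmin ⟨hz, hzr⟩
  · have h1 : dist y x ≤ dist y x₀ := hmin ⟨h0, Metric.mem_closedBall_self hr.le⟩
    rw [Metric.mem_closedBall, not_le] at hzr
    have h2 := dist_triangle z y x₀
    rw [dist_comm z y] at h2
    have h3 : dist y x₀ < r / 2 := hy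
    linarith

/-- A nearest point of `y` lies within `2 dist y x₀` of `x₀`, hence in a chart, where it is a foot
of `y` on a regular parametrization `g` of `X`; feet are unique. -/
theorem IsC2Submanifold.eventually_isNearestPoint_unique {X : Set 𝔼} (hX : IsC2Submanifold 1 X)
    {x₀ : 𝔼} (h0 : x₀ ∈ X) :
    ∀ᶠ y in 𝓝 x₀, ∀ x x', IsNearestPoint X y x → IsNearestPoint X y x' → x = x' := by
  obtain ⟨Φ, V, h0Φ, hΦ, hΨ, hV, hiff⟩ := hX x₀ h0
  obtain ⟨w, hw0, hw⟩ := finrank_eq_one_iff'.1 hV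
  let σ : 𝔼 → ℝ := fun x => inner ℝ (w : 𝔼) (Φ x) / ‖(w : 𝔼)‖ ^ 2
  have hwn : ‖(w : 𝔼)‖ ^ 2 ≠ 0 := by simpa using hw0
  let g : ℝ → 𝔼 := fun s => Φ.symm (s • (w : 𝔼))
  have hσ : ∀ x ∈ X, x ∈ Φ.source → σ x • (w : 𝔼) = Φ x := fun x hx hxΦ => by
    obtain ⟨c, hc⟩ := hw ⟨Φ x, (hiff x hxΦ).1 hx⟩
    have hc' : Φ x = c • (w : 𝔼) := (congrArg Subtype.val hc).symm
    simp only [σ, hc', inner_smul_right, real_inner_self_eq_norm_sq]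
    rw [mul_div_cancel_right₀ _ hwn]
  have hgσ : ∀ x ∈ X, x ∈ Φ.source → g (σ x) = x := fun x hx hxΦ => by
    simp only [g, hσ x hx hxΦ, Φ.left_inv hxΦ]
  have htar : ∀ x ∈ X, x ∈ Φ.source → σ x • (w : 𝔼) ∈ Φ.target := fun x hx hxΦ => by
    rw [hσ x hx hxΦ]
    exact Φ.map_source hxΦ
  have hgC : ∀ s : ℝ, s • (w : 𝔼) ∈ Φ.target → ContDiffAt ℝ 2 g s := fun s hs =>
    (hΨ.contDiffAt (Φ.open_target.mem_nhds hs)).comp s (by fun_prop)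
  have hgX : ∀ s : ℝ, s • (w : 𝔼) ∈ Φ.target → g s ∈ X := fun s hs => by
    rw [hiff _ (Φ.map_target hs), Φ.right_inv hs]
    exact V.smul_mem _ w.2
  have hev : ∀ s : ℝ, s • (w : 𝔼) ∈ Φ.target → ∀ᶠ t in 𝓝 s, t • (w : 𝔼) ∈ Φ.target :=
    fun s hs => (show ContinuousAt (fun t : ℝ => t • (w : 𝔼)) s by fun_prop).eventually
      (Φ.open_target.mem_nhds hs)
  have ht0 := htar x₀ h0 h0Φ
  -- `Φ ∘ g` is `t ↦ t • w` near `σ x₀`, so a zero derivative of `g` would make `w` zero.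
  have hreg : deriv g (σ x₀) ≠ 0 := fun h => by
    have hg0 := ((hgC _ ht0).differentiableAt (by norm_num)).hasDerivAt
    rw [h] at hg0
    have hΦ0 : HasFDerivAt Φ (fderiv ℝ Φ x₀) (g (σ x₀)) := by
      rw [hgσ x₀ h0 h0Φ]
      exact ((hΦ.contDiffAt (Φ.open_source.mem_nhds h0Φ)).differentiableAt
        (by norm_num)).hasFDerivAt
    have hc := hΦ0.comp_hasDerivAt _ hg0
    have hl : HasDerivAt (fun t : ℝ => t • (w : 𝔼)) (w : 𝔼) (σ x₀) := by
      simpa using (hasDerivAt_id (σ x₀)).smul_const (w : 𝔼)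
    have := hl.unique (hc.congr_of_eventuallyEq (by
      filter_upwards [hev _ ht0] with t ht using (Φ.right_inv ht).symm))
    exact hw0 (by simpa using this)
  obtain ⟨ε, hε, huniq⟩ := exists_forall_eq_of_inner_deriv_eq_zero (hgC _ ht0) hreg
  rw [hgσ x₀ h0 h0Φ] at huniq
  have hσc : ContinuousAt σ x₀ := by
    have : ContinuousAt Φ x₀ := Φ.continuousAt h0Φ
    exact (continuousAt_const.inner this).div_const _
  have hnear : ∀ᶠ x in 𝓝 x₀, x ∈ Φ.source ∧ |σ x - σ x₀| < ε :=
    Filter.Eventually.and (Φ.open_source.mem_nhds h0Φ) (Metric.tendsto_nhds.1 hσc ε hε)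
  obtain ⟨ρ, hρ, hnear⟩ := Metric.eventually_nhds_iff.1 hnear
  have hfoot : ∀ y x, dist y x₀ < ρ / 2 → IsNearestPoint X y x → x ∈ Φ.source ∧
      |σ x - σ x₀| < ε ∧ inner ℝ (y - g (σ x)) (deriv g (σ x)) = 0 := by
    intro y x hy hx
    have hxρ : dist x x₀ < ρ := by
      have := hx.2 x₀ h0
      have := dist_triangle x y x₀
      rw [dist_comm x y] at this
      linarith
    obtain ⟨hxΦ, hxε⟩ := hnear hxρ
    refine ⟨hxΦ, hxε, ?_⟩
    have hxt := htar x hx.1 hxΦ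
    have hd := ((hgC _ hxt).differentiableAt (by norm_num)).hasDerivAt
    have hmin : IsLocalMin (fun s => ‖y - g s‖ ^ 2) (σ x) := by
      filter_upwards [hev _ hxt] with s hs
      have := hx.2 _ (hgX s hs)
      rw [dist_eq_norm, dist_eq_norm] at this
      rw [hgσ x hx.1 hxΦ]
      gcongr
    have := hmin.hasDerivAt_eq_zero (hd.const_sub y).norm_sq
    simpa using this
  filter_upwards [Metric.ball_mem_nhds x₀ (half_pos hρ), Metric.ball_mem_nhds x₀ hε]
    with y hy hyε x x' hx hx'
  obtain ⟨h1, h2, h3⟩ := hfoot y x hy hx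
  obtain ⟨h1', h2', h3'⟩ := hfoot y x' hy hx'
  rw [← hgσ x hx.1 h1, ← hgσ x' hx'.1 h1',
    huniq y _ _ (by simpa [dist_eq_norm] using hyε) h2 h2' h3 h3']

theorem IsNearestPoint.nearestPoint {X : Set 𝔼} {y x : 𝔼} (h : IsNearestPoint X y x) :
    IsNearestPoint X y (nearestPoint X y) :=
  Classical.epsilon_spec (p := fun x => x ∈ X ∧ ∀ z ∈ X, dist y x ≤ dist y z) ⟨x, h⟩

/-! ### Angles -/

theorem inner_le_distToSubspace (v : 𝔼) {B : Submodule ℝ 𝔼} {u : 𝔼} (hu : u ∈ Bᗮ)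
    (hu1 : ‖u‖ = 1) : inner ℝ v u ≤ distToSubspace v B := by
  refine le_csSup ⟨‖v‖, ?_⟩ ⟨u, hu, hu1, rfl⟩
  rintro _ ⟨u, -, hu1, rfl⟩
  simpa [hu1] using real_inner_le_norm v u

theorem abs_inner_le_distToSubspace (v : 𝔼) {B : Submodule ℝ 𝔼} {u : 𝔼} (hu : u ∈ Bᗮ)
    (hu1 : ‖u‖ = 1) : |inner ℝ v u| ≤ distToSubspace v B := by
  refine abs_le'.2 ⟨inner_le_distToSubspace v hu hu1, ?_⟩
  simpa using inner_le_distToSubspace v (B := B) (u := -u) (neg_mem hu) (by simpa using hu1)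

theorem distToSubspace_nonneg (v : 𝔼) (B : Submodule ℝ 𝔼) : 0 ≤ distToSubspace v B := by
  rcases Set.eq_empty_or_nonempty {r : ℝ | ∃ u ∈ Bᗮ, ‖u‖ = 1 ∧ r = inner ℝ v u} with h | h
  · simp [distToSubspace, h]
  · obtain ⟨r, u, hu, hu1, -⟩ := h
    exact (abs_nonneg _).trans (abs_inner_le_distToSubspace v hu hu1)

theorem distToSubspace_le_norm (v : 𝔼) (B : Submodule ℝ 𝔼) : distToSubspace v B ≤ ‖v‖ := by
  refine Real.sSup_le ?_ (norm_nonneg v)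
  rintro _ ⟨u, -, hu1, rfl⟩
  simpa [hu1] using real_inner_le_norm v u

theorem subspaceDelta_nonneg (A B : Submodule ℝ 𝔼) : 0 ≤ subspaceDelta A B := by
  refine Real.sSup_nonneg ?_
  rintro _ ⟨v, -, -, rfl⟩
  exact distToSubspace_nonneg v B

theorem inner_le_subspaceDelta {A B : Submodule ℝ 𝔼} {v u : 𝔼} (hv : v ∈ A) (hv1 : ‖v‖ = 1)
    (hu : u ∈ Bᗮ) (hu1 : ‖u‖ = 1) : inner ℝ v u ≤ subspaceDelta A B := by
  refine (inner_le_distToSubspace v hu hu1).trans (le_csSup ⟨1, ?_⟩ ⟨v, hv, hv1, rfl⟩)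
  rintro _ ⟨v, -, hv1, rfl⟩
  exact hv1 ▸ distToSubspace_le_norm v B

theorem exists_lt_inner_of_lt_subspaceDelta {A B : Submodule ℝ 𝔼} {r : ℝ} (hr : 0 ≤ r)
    (h : r < subspaceDelta A B) :
    ∃ v ∈ A, ‖v‖ = 1 ∧ ∃ u ∈ Bᗮ, ‖u‖ = 1 ∧ r < inner ℝ v u := by
  -- As `0 ≤ r`, the default value `0` of an empty supremum cannot exceed `r`.
  have key : ∀ s : Set ℝ, r < sSup s → ∃ x ∈ s, r < x := fun s hs => by
    by_contra! hle
    exact absurd (Real.sSup_le hle hr) (not_le.2 hs)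
  obtain ⟨_, ⟨v, hv, hv1, rfl⟩, hlt⟩ := key _ h
  obtain ⟨_, ⟨u, hu, hu1, rfl⟩, hlt⟩ := key _ hlt
  exact ⟨v, hv, hv1, u, hu, hu1, hlt⟩

end NearestPoint

/-! ### Definability of the violation and derivatives of definable curves -/

section Main

variable {n : ℕ} {L : FirstOrder.Language} [L.Structure ℝ]

local notation "𝔼" => EuclideanSpace ℝ (Fin n)

theorem IsDefinableSet.definablePred {M : Set 𝔼} (hM : IsDefinableSet L M) :
    DefinablePred L fun y => y ∈ M := hM

theorem IsDefinableSet.definablePred_isNormalAt (hL : IsOMinimalExpansion L) {M : Set 𝔼}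
    (hM : IsDefinableSet L M) : DefinablePred L fun q : 𝔼 × 𝔼 => IsNormalAt M q.1 q.2 := by
  have hz : ∀ {F : Type} [RealCoordinates F] {y z : F → 𝔼}, DefinableMap L y → DefinableMap L z →
      DefinableMap L fun p => ‖z p - y p‖ := fun hy hz => (hz.vsub hL hy).norm hL
  refine (DefinablePred.all (P := fun (q : 𝔼 × 𝔼) (ε : ℝ) => 0 < ε → ∃ δ : ℝ, 0 < δ ∧
    ∀ z : 𝔼, ‖z - q.1‖ < δ → z ∈ M → inner ℝ q.2 (z - q.1) ≤ ε * ‖z - q.1‖ ∧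
      -(ε * ‖z - q.1‖) ≤ inner ℝ q.2 (z - q.1)) (.imp (.lt hL (.const 0) .snd)
    (.ex (P := fun (q : (𝔼 × 𝔼) × ℝ) (δ : ℝ) => 0 < δ ∧
      ∀ z : 𝔼, ‖z - q.1.1‖ < δ → z ∈ M → inner ℝ q.1.2 (z - q.1.1) ≤ q.2 * ‖z - q.1.1‖ ∧
        -(q.2 * ‖z - q.1.1‖) ≤ inner ℝ q.1.2 (z - q.1.1)) (.and (.lt hL (.const 0) .snd)
      (.all (P := fun (q : ((𝔼 × 𝔼) × ℝ) × ℝ) (z : 𝔼) => ‖z - q.1.1.1‖ < q.2 → z ∈ M →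
        inner ℝ q.1.1.2 (z - q.1.1.1) ≤ q.1.2 * ‖z - q.1.1.1‖ ∧
          -(q.1.2 * ‖z - q.1.1.1‖) ≤ inner ℝ q.1.1.2 (z - q.1.1.1)) ?_))))).congr
    fun q => isNormalAt_iff
  have hy : DefinableMap L fun p : (((𝔼 × 𝔼) × ℝ) × ℝ) × 𝔼 => p.1.1.1.1 :=
    .fst' (.fst' (.fst' .fst))
  have hu : DefinableMap L fun p : (((𝔼 × 𝔼) × ℝ) × ℝ) × 𝔼 => p.1.1.1.2 :=
    .snd' (.fst' (.fst' .fst))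
  have he : DefinableMap L fun p : (((𝔼 × 𝔼) × ℝ) × ℝ) × 𝔼 => p.1.1.2 := .snd' (.fst' .fst)
  have hi := hu.inner hL (DefinableMap.vsub hL .snd hy)
  have hen := he.mul hL (hz hy .snd)
  exact .imp (.lt hL (hz hy .snd) (.snd' .fst)) (.imp (.comp hM.definablePred .snd)
    (.and (.le hL hi hen) (.le hL (hen.neg hL) hi)))

theorem IsDefinableSet.definablePred_isNearestPoint (hL : IsOMinimalExpansion L) {X : Set 𝔼}
    (hX : IsDefinableSet L X) : DefinablePred L fun q : 𝔼 × 𝔼 => IsNearestPoint X q.1 q.2 := by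
  simp only [IsNearestPoint, dist_eq_norm]
  exact .and (.comp hX.definablePred .snd)
    (.all (P := fun (q : 𝔼 × 𝔼) z => z ∈ X → ‖q.1 - q.2‖ ≤ ‖q.1 - z‖)
      (.imp (.comp hX.definablePred .snd) (.le hL ((DefinableMap.vsub hL (.fst' .fst)
        (.snd' .fst)).norm hL) ((DefinableMap.vsub hL (.fst' .fst) .snd).norm hL))))

/-- The nearest point `x` on `X` to the point `y` of `Y` violates the ratio test with constant `ε`:
some unit vectors `v` tangent to `X` at `x` and `u` normal to `Y` at `y` satisfy
`ε * |y - x| < ⟨v, u⟩ * |y|`. -/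
def ViolatesRatioTest (X Y : Set 𝔼) (ε : ℝ) (y x : 𝔼) : Prop :=
  y ∈ Y ∧ IsNearestPoint X y x ∧ ∃ u v : 𝔼, IsNormalAt Y y u ∧ ‖u‖ = 1 ∧
    (∀ w, IsNormalAt X x w → inner ℝ w v = 0) ∧ ‖v‖ = 1 ∧ ε * ‖y - x‖ < inner ℝ v u * ‖y‖

theorem definablePred_violatesRatioTest (hL : IsOMinimalExpansion L) {X Y : Set 𝔼}
    (hX : IsDefinableSet L X) (hY : IsDefinableSet L Y) (ε : ℝ) :
    DefinablePred L fun q : 𝔼 × 𝔼 => ViolatesRatioTest X Y ε q.1 q.2 := by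
  refine .and (.comp hY.definablePred .fst) (.and (hX.definablePred_isNearestPoint hL)
    (.ex (P := fun (q : 𝔼 × 𝔼) u => ∃ v : 𝔼, IsNormalAt Y q.1 u ∧ ‖u‖ = 1 ∧
      (∀ w, IsNormalAt X q.2 w → inner ℝ w v = 0) ∧ ‖v‖ = 1 ∧
        ε * ‖q.1 - q.2‖ < inner ℝ v u * ‖q.1‖)
    (.ex (P := fun (q : (𝔼 × 𝔼) × 𝔼) v => IsNormalAt Y q.1.1 q.2 ∧ ‖q.2‖ = 1 ∧
      (∀ w, IsNormalAt X q.1.2 w → inner ℝ w v = 0) ∧ ‖v‖ = 1 ∧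
        ε * ‖q.1.1 - q.1.2‖ < inner ℝ v q.2 * ‖q.1.1‖) ?_)))
  have hy : DefinableMap L fun p : ((𝔼 × 𝔼) × 𝔼) × 𝔼 => p.1.1.1 := .fst' (.fst' .fst)
  have hx : DefinableMap L fun p : ((𝔼 × 𝔼) × 𝔼) × 𝔼 => p.1.1.2 := .snd' (.fst' .fst)
  have hu : DefinableMap L fun p : ((𝔼 × 𝔼) × 𝔼) × 𝔼 => p.1.2 := .snd' .fst
  have hv : DefinableMap L fun p : ((𝔼 × 𝔼) × 𝔼) × 𝔼 => p.2 := .snd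
  refine .and (.comp₂ (hY.definablePred_isNormalAt hL) hy hu) (.and (.eq (hu.norm hL) (.const 1))
    (.and (.all (P := fun (p : ((𝔼 × 𝔼) × 𝔼) × 𝔼) w => IsNormalAt X p.1.1.2 w →
      inner ℝ w p.2 = 0) (.imp ?_ ?_)) (.and (.eq (hv.norm hL) (.const 1)) ?_)))
  · exact .comp₂ (hX.definablePred_isNormalAt hL) (.snd' (.fst' (.fst' .fst))) .snd
  · exact .eq (.inner hL .snd (.snd' .fst)) (.const 0)
  · exact .lt hL (.mul hL (.const ε) ((hy.vsub hL hx).norm hL))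
      ((hv.inner hL hu).mul hL (hy.norm hL))

theorem EuclideanSpace.norm_le_sum_abs (v : 𝔼) : ‖v‖ ≤ ∑ i, |v i| := by
  rw [EuclideanSpace.norm_eq]
  refine Real.sqrt_le_iff.2 ⟨Finset.sum_nonneg fun i _ => abs_nonneg _, ?_⟩
  simpa using Finset.sum_sq_le_sq_sum_of_nonneg (s := Finset.univ) fun i _ => abs_nonneg (v i)

/-- The difference `z` of two definable curves approaching each other is, at arbitrarily small
parameters `t`, differentiable with `z' = r' û + |z| u'`, where `û = z / |z|`, `t r' = O(|z|)` and
`t u' → 0`. -/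
theorem exists_frequently_hasDerivAt (hL : IsOMinimalExpansion L) (hpb : IsPolynomiallyBounded L)
    {y x : ℝ → 𝔼} (hy : DefinableMap L y) (hx : DefinableMap L x)
    (hne : ∀ᶠ t in 𝓝[>] (0 : ℝ), y t - x t ≠ 0)
    (h0 : Tendsto (fun t => ‖y t - x t‖) (𝓝[>] 0) (𝓝 0)) :
    ∃ (C : ℝ) (ω : ℝ → ℝ), 0 ≤ C ∧ Tendsto ω (𝓝[>] 0) (𝓝 0) ∧ ∃ᶠ t in 𝓝[>] (0 : ℝ),
      ∃ (y' x' u' : 𝔼) (r' : ℝ), HasDerivAt y y' t ∧ HasDerivAt x x' t ∧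
        y' - x' = r' • (‖y t - x t‖⁻¹ • (y t - x t)) + ‖y t - x t‖ • u' ∧
        t * |r'| ≤ C * ‖y t - x t‖ ∧ t * ‖u'‖ ≤ ω t := by
  set z : ℝ → 𝔼 := fun t => y t - x t with hz_def
  set U : ℝ → 𝔼 := fun t => ‖z t‖⁻¹ • z t with hU_def
  have hz : DefinableMap L z := hy.vsub hL hx
  have hUi : ∀ i, DefinableMap L fun t => U t i := fun i =>
    ((hz.norm hL).inv hL).mul hL (hz.apply i)
  have hU1 : ∀ t, ‖U t‖ ≤ 1 := fun t => by
    rw [hU_def, norm_smul, norm_inv, norm_norm]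
    exact inv_mul_le_one
  have hlim : ∀ i, ∃ ℓ, Tendsto (fun t => U t i) (𝓝[>] 0) (𝓝 ℓ) := fun i =>
    hL.exists_tendsto_nhdsGT_zero (hUi i) (C := 1) (Eventually.of_forall fun t =>
      (PiLp.norm_apply_le (U t) i).trans (hU1 t))
  choose ℓ hℓ using hlim
  have hUℓ : ∀ i, Tendsto (fun t => U t i - ℓ i) (𝓝[>] 0) (𝓝 0) := fun i => by
    simpa using (hℓ i).sub_const (ℓ i)
  -- Subtracting the limits `ℓ i` makes the derivative estimate applicable, and its right-hand side
  -- then tends to `0`.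
  choose c hc using fun i => hpb.exists_mul_deriv_le hL ((hUi i).sub hL (.const (ℓ i))) (hUℓ i)
  obtain ⟨C, hC⟩ := hpb.exists_mul_deriv_le hL (hz.norm hL) h0
  refine ⟨|C|, fun t => ∑ i, c i * |U t i - ℓ i|, abs_nonneg C, ?_, ?_⟩
  · simpa using tendsto_finsetSum Finset.univ fun i _ => (hUℓ i).abs.const_mul (c i)
  have hgood := (eventually_all.2 hc).and (hC.and (hne.and self_mem_nhdsWithin))
  have hdiff : ∀ᶠ δ in 𝓝[>] (0 : ℝ), ∀ᵐ t, t ∈ Set.Ioo 0 δ →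
      DifferentiableAt ℝ y t ∧ DifferentiableAt ℝ x t := by
    filter_upwards [eventually_all.2 fun i => hL.eventually_ae_differentiableAt (hy.apply i),
      eventually_all.2 fun i => hL.eventually_ae_differentiableAt (hx.apply i)] with δ h1 h2
    filter_upwards [MeasureTheory.ae_all_iff.2 h1, MeasureTheory.ae_all_iff.2 h2] with t h1 h2 ht
    exact ⟨differentiableAt_euclidean.2 fun i => h1 i ht,
      differentiableAt_euclidean.2 fun i => h2 i ht⟩
  obtain ⟨δ, hδ, hδ0⟩ := (hdiff.and self_mem_nhdsWithin).exists
  -- All other requirements hold for every small `t`, and differentiability holds almost everywhere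
  -- on an interval, which has positive measure.
  intro hcon
  obtain ⟨δ', hδ', hI⟩ := mem_nhdsGT_iff_exists_Ioo_subset.1 (hcon.and hgood)
  have hpos : 0 < min δ δ' := lt_min hδ0 hδ'
  obtain ⟨t, ht, htδ⟩ : ∃ t, (t ∈ Set.Ioo 0 δ → DifferentiableAt ℝ y t ∧ DifferentiableAt ℝ x t) ∧
      t ∈ Set.Ioo 0 (min δ δ') := by
    by_contra! h
    have hzero : MeasureTheory.volume (Set.Ioo 0 (min δ δ')) = 0 :=
      MeasureTheory.measure_mono_null (fun t ht => by
        have := h t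
        exact fun h' => this h' ht) hδ
    rw [Real.volume_Ioo] at hzero
    rw [sub_zero, ENNReal.ofReal_eq_zero] at hzero
    exact hpos.not_ge hzero
  obtain ⟨hyd, hxd⟩ := ht ⟨htδ.1, htδ.2.trans_le (min_le_left _ _)⟩
  obtain ⟨hnot, hct, hCt, hzt, ht0⟩ := hI ⟨htδ.1, htδ.2.trans_le (min_le_right _ _)⟩
  refine hnot ?_
  have hzd : DifferentiableAt ℝ z t := hyd.sub hxd
  have hρd : DifferentiableAt ℝ (fun t => ‖z t‖) t := hzd.norm ℝ hzt
  have hUd : DifferentiableAt ℝ U t := (hρd.inv (norm_ne_zero_iff.2 hzt)).smul hzd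
  have hzU : z = fun t => ‖z t‖ • U t := by
    funext t
    rcases eq_or_ne (z t) 0 with h | h
    · simp [h]
    · simp [hU_def, smul_smul, mul_inv_cancel₀ (norm_ne_zero_iff.2 h)]
  refine ⟨_, _, deriv U t, deriv (fun t => ‖z t‖) t, hyd.hasDerivAt, hxd.hasDerivAt, ?_, ?_, ?_⟩
  · have h1 : HasDerivAt z (deriv y t - deriv x t) t := hyd.hasDerivAt.sub hxd.hasDerivAt
    have h2 := hρd.hasDerivAt.fun_smul hUd.hasDerivAt
    rw [← hzU] at h2
    rw [h1.unique h2, add_comm]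
  · have := hCt _ hρd.hasDerivAt
    rw [abs_mul, abs_of_pos ht0, abs_of_nonneg (norm_nonneg (z t))] at this
    exact this.trans (by gcongr; exact le_abs_self C)
  · have hle : ∀ i, t * |deriv U t i| ≤ c i * |U t i - ℓ i| := fun i => by
      have hi : HasDerivAt (fun t => U t i) (deriv U t i) t :=
        (EuclideanSpace.proj i : 𝔼 →L[ℝ] ℝ).hasFDerivAt.comp_hasDerivAt t hUd.hasDerivAt
      have := hct i _ (hi.sub_const (ℓ i))
      rwa [abs_mul, abs_of_pos ht0] at this
    calc t * ‖deriv U t‖ ≤ t * ∑ i, |deriv U t i| := by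
          gcongr
          exact EuclideanSpace.norm_le_sum_abs _
      _ ≤ _ := by
          rw [Finset.mul_sum]
          exact Finset.sum_le_sum fun i _ => hle i

end Main

/-! ### The curve along which the ratio test fails -/

section Main

variable {n : ℕ} {L : FirstOrder.Language} [L.Structure ℝ]

local notation "𝔼" => EuclideanSpace ℝ (Fin n)

theorem mem_tangentSpaceAt_of_hasDerivAt {M : Set 𝔼} {γ : ℝ → 𝔼} {v : 𝔼} {t : ℝ}
    (hM : ∀ᶠ s in 𝓝 t, γ s ∈ M) (hγ : HasDerivAt γ v t) : v ∈ tangentSpaceAt M (γ t) := by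
  have hc : Tendsto (fun s : ℝ => s + t) (𝓝 0) (𝓝 t) := by
    simpa using (continuous_add_const t).tendsto 0
  refine Submodule.subset_span ⟨fun s => γ (s + t), by simp, hc.eventually hM, ?_⟩
  exact HasDerivAt.comp_add_const 0 t (by simpa using hγ)

/-- Differentiate `‖y s‖² = s²` and use Cauchy–Schwarz. -/
theorem one_le_norm_of_hasDerivAt {y : ℝ → 𝔼} {y' : 𝔼} {t : ℝ} (ht : 0 < t)
    (hy : ∀ᶠ s in 𝓝 t, ‖y s‖ = s) (hd : HasDerivAt y y' t) : 1 ≤ ‖y'‖ := by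
  have h1 : 2 * inner ℝ (y t) y' = 2 * t := by
    refine hd.norm_sq.unique (HasDerivAt.congr_of_eventuallyEq (f := fun s => s ^ 2) ?_ ?_)
    · simpa using hasDerivAt_pow 2 t
    · filter_upwards [hy] with s hs
      rw [hs]
  have h2 := real_inner_le_norm (y t) y'
  rw [hy.self_of_nhds] at h2
  have : t * 1 ≤ t * ‖y'‖ := by linarith
  exact le_of_mul_le_mul_left this ht

/-- The norms of violating points form a definable set of positive numbers accumulating at `0`,
hence containing an interval `(0, δ)`. Fixing `‖y‖ = t` keeps the fibres bounded; as `0 ∈ X`,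
nearest points then satisfy `‖x‖ ≤ 2 ‖y‖`. -/
theorem exists_definable_curve_violating (hL : IsOMinimalExpansion L) {X Y : Set 𝔼}
    (hX : IsDefinableSet L X) (hY : IsDefinableSet L Y) (h0 : 0 ∈ X) (hXY : Disjoint X Y) {ε : ℝ}
    (hfreq : ∃ᶠ y in 𝓝 0, ∃ x, ViolatesRatioTest X Y ε y x) :
    ∃ y x : ℝ → 𝔼, DefinableMap L y ∧ DefinableMap L x ∧
      ∀ᶠ t in 𝓝[>] (0 : ℝ), ViolatesRatioTest X Y ε (y t) (x t) ∧ ‖y t‖ = t := by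
  have hS := definablePred_violatesRatioTest hL hX hY ε
  have hT : DefinablePred L fun q : ℝ × 𝔼 => ∃ x, ViolatesRatioTest X Y ε q.2 x ∧ ‖q.2‖ = q.1 :=
    .ex (P := fun (q : ℝ × 𝔼) x => ViolatesRatioTest X Y ε q.2 x ∧ ‖q.2‖ = q.1)
      (.and (.comp₂ hS (.snd' .fst) .snd) (.eq (.norm hL (.snd' .fst)) (.fst' .fst)))
  obtain ⟨y, hy, hyS⟩ := exists_definable_choice hL
    (S := fun t y => ∃ x, ViolatesRatioTest X Y ε y x ∧ ‖y‖ = t) hT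
    fun t => ⟨t, fun y ⟨x, _, h⟩ => h.le⟩
  obtain ⟨x, hx, hxS⟩ := exists_definable_choice hL
    (S := fun t x => ViolatesRatioTest X Y ε (y t) x)
    (.comp₂ hS (.comp hy .fst) .snd) fun t => ⟨‖y t‖ + ‖y t‖, fun x hx => by
      have h1 := hx.2.1.2 0 h0
      rw [dist_eq_norm, dist_zero_right] at h1
      have h2 := norm_le_norm_add_norm_sub (y t) x
      linarith⟩
  refine ⟨y, x, hy, hx, ?_⟩
  rcases hL.eventually_nhdsGT_or (DefinablePred.ex (F := 𝔼)
    (P := fun t y => ∃ x, ViolatesRatioTest X Y ε y x ∧ ‖y‖ = t) hT) 0 with h | h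
  · filter_upwards [h] with t ht
    obtain ⟨x', hx', hnorm⟩ := hyS t ht
    exact ⟨hxS t ⟨x', hx'⟩, hnorm⟩
  · obtain ⟨δ, hδ, hI⟩ := mem_nhdsGT_iff_exists_Ioo_subset.1 h
    obtain ⟨w, ⟨x', hw⟩, hwδ⟩ := (hfreq.and_eventually (Metric.ball_mem_nhds 0 hδ)).exists
    refine absurd ⟨w, x', hw, rfl⟩ (hI (a := ‖w‖) ⟨norm_pos_iff.2 fun h => ?_, by simpa using hwδ⟩)
    exact Set.disjoint_left.1 hXY h0 (h ▸ hw.1)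

end Main

end

theorem proposition3p1 (L : FirstOrder.Language) [L.Structure ℝ]
    (hL : IsOMinimalExpansion L) (hpb : IsPolynomiallyBounded L)
    {n d : ℕ} (X Y : Set (EuclideanSpace ℝ (Fin n)))
    (hX : IsC2Submanifold 1 X) (hY : IsC2Submanifold d Y)
    (hXdef : IsDefinableSet L X) (hYdef : IsDefinableSet L Y)
    (hXY : Disjoint X Y) (h0 : (0 : EuclideanSpace ℝ (Fin n)) ∈ X ∩ closure Y)
    (hb : WhitneyBAt Y X 0) :
    KuoRatioTestAt Y X 0 := by
  have hproj : ∀ᶠ y in 𝓝 (0 : EuclideanSpace ℝ (Fin n)), IsNearestPoint X y (nearestPoint X y) ∧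
      ∀ x, IsNearestPoint X y x → x = nearestPoint X y := by
    filter_upwards [hX.eventually_exists_isNearestPoint h0.1,
      hX.eventually_isNearestPoint_unique h0.1] with y ⟨x, hx⟩ huniq
    exact ⟨hx.nearestPoint, fun x' hx' => huniq _ _ hx' hx.nearestPoint⟩
  have hne : ∀ {y x}, y ∈ Y → x ∈ X → y - x ≠ 0 := fun {y x} hy hx h =>
    Set.disjoint_left.1 hXY hx (sub_eq_zero.1 h ▸ hy)
  -- Otherwise the ratio test fails along a definable curve `y`, parametrized by `‖y t‖ = t`.
  rw [KuoRatioTestAt, Metric.tendsto_nhds]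
  by_contra! hfail
  obtain ⟨ε, hε, hfail⟩ := hfail
  have hfreq : ∃ᶠ y in 𝓝 0, ∃ x, ViolatesRatioTest X Y (ε / 2) y x := by
    have h := hfail.and_eventually
      (Filter.Eventually.and self_mem_nhdsWithin (nhdsWithin_le_nhds hproj))
    refine (h.filter_mono nhdsWithin_le_nhds).mono ?_
    rintro y ⟨hy, hyY, hyX, -⟩
    have hz : 0 < ‖y - nearestPoint X y‖ := norm_pos_iff.2 (hne hyY hyX.1)
    have hα : 0 ≤ tangentAngle Y X y := subspaceDelta_nonneg _ _
    have hy0 : 0 < ‖y‖ := norm_pos_iff.2 (by simpa using hne hyY h0.1)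
    rw [Real.dist_eq, sub_zero, sub_zero, abs_of_nonneg (by positivity),
      le_div_iff₀ hz] at hy
    -- Halving `ε` makes the inequality strict, so that vectors nearly attaining the suprema still
    -- violate it.
    have hlt : ε / 2 * ‖y - nearestPoint X y‖ / ‖y‖ < tangentAngle Y X y := by
      rw [div_lt_iff₀ hy0]
      nlinarith
    obtain ⟨v, hv, hv1, u, hu, hu1, hlt⟩ :=
      exists_lt_inner_of_lt_subspaceDelta (by positivity) hlt
    exact ⟨_, hyY, hyX, u, v, (hY.isNormalAt_iff_mem_orthogonal hyY).2 hu, hu1,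
      (hX.mem_tangentSpaceAt_iff hyX.1).1 hv, hv1, (div_lt_iff₀ hy0).1 hlt⟩
  obtain ⟨y, x, hy, hx, hyx⟩ := exists_definable_curve_violating hL hXdef hYdef h0.1 hXY hfreq
  have hy0 : Tendsto y (𝓝[>] 0) (𝓝 0) := by
    refine tendsto_zero_iff_norm_tendsto_zero.2
      ((tendsto_id.mono_left nhdsWithin_le_nhds).congr' ?_)
    filter_upwards [hyx] with t ht using ht.2.symm
  have hyY : Tendsto y (𝓝[>] 0) (𝓝[Y] 0) :=
    tendsto_nhdsWithin_iff.2 ⟨hy0, hyx.mono fun t ht => ht.1.1⟩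
  have hz0 : Tendsto (fun t => ‖y t - x t‖) (𝓝[>] 0) (𝓝 0) := by
    refine tendsto_of_tendsto_of_tendsto_of_le_of_le' tendsto_const_nhds
      (tendsto_zero_iff_norm_tendsto_zero.1 hy0) (Eventually.of_forall fun t => norm_nonneg _) ?_
    filter_upwards [hyx] with t ht
    simpa [dist_eq_norm] using ht.1.2.1.2 0 h0.1
  obtain ⟨C, ω, hC, hω, hderiv⟩ := exists_frequently_hasDerivAt hL hpb hy hx
    (hyx.mono fun t ht => hne ht.1.1 ht.1.2.1.1) hz0
  have hα := hb.1.comp hyY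
  have hβ := hb.2.comp hyY
  have hsmall₁ : ∀ᶠ t in 𝓝[>] (0 : ℝ), tangentAngle Y X (y t) * (C + 1) < ε / 4 := by
    have := hα.mul_const (C + 1)
    rw [zero_mul] at this
    exact this.eventually (gt_mem_nhds (by positivity))
  have hsmall₂ : ∀ᶠ t in 𝓝[>] (0 : ℝ), C * secantAngle Y X (y t) + ω t < ε / 4 := by
    have := (hβ.const_mul C).add hω
    rw [mul_zero, add_zero] at this
    exact this.eventually (gt_mem_nhds (by positivity))
  obtain ⟨t, ⟨y', x', u', r', hy', hx', hdec, hr', hu'⟩, hnhds, hproj, h1, h2, h3, ht⟩ :=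
    (hderiv.and_eventually ((eventually_eventually_nhdsWithin.2 hyx).and
      ((hy0.eventually hproj).and (hsmall₁.and (hsmall₂.and
        ((hω.eventually (gt_mem_nhds one_pos)).and self_mem_nhdsWithin)))))).exists
  rw [isOpen_Ioi.nhdsWithin_eq ht] at hnhds
  obtain ⟨⟨htY, htX, u, v, hu, hu1, hv, hv1, hviol⟩, hnorm⟩ := hnhds.self_of_nhds
  have hπ : x t = nearestPoint X (y t) := hproj.2 _ htX
  have hu := (hY.isNormalAt_iff_mem_orthogonal htY).1 hu
  have hv := (hX.mem_tangentSpaceAt_iff htX.1).2 hv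
  have hy'T := mem_tangentSpaceAt_of_hasDerivAt (hnhds.mono fun s hs => hs.1.1) hy'
  have hx'T := mem_tangentSpaceAt_of_hasDerivAt (hnhds.mono fun s hs => hs.1.2.1.1) hx'
  set ρ := ‖y t - x t‖ with hρ_def
  set U := ρ⁻¹ • (y t - x t) with hU_def
  have hρ : 0 < ρ := norm_pos_iff.2 (hne htY htX.1)
  have hU1 : ‖U‖ = 1 := by
    rw [hU_def, norm_smul, norm_inv, Real.norm_of_nonneg hρ.le, ← hρ_def, inv_mul_cancel₀ hρ.ne']
  have hα' : inner ℝ v u ≤ tangentAngle Y X (y t) :=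
    inner_le_subspaceDelta (hπ ▸ hv) hv1 hu hu1
  have hβ' : |inner ℝ U u| ≤ secantAngle Y X (y t) := by
    rw [secantAngle, ← hπ]
    exact abs_inner_le_distToSubspace _ hu hu1
  clear_value U
  rw [hnorm] at hviol
  -- The violation gives `ρ ≤ (2/ε) α t`, so `t ‖y' - x'‖ ≤ ρ (C + 1) < t / 2`, while `‖y'‖ ≥ 1`.
  have hx'norm : 1 / 2 ≤ ‖x'‖ := by
    have hz' : t * ‖y' - x'‖ ≤ ρ * (C + 1) := by
      calc t * ‖y' - x'‖ ≤ t * (|r'| + ρ * ‖u'‖) := by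
            rw [hdec]
            gcongr
            refine (norm_add_le _ _).trans (le_of_eq ?_)
            rw [norm_smul, norm_smul, hU1, Real.norm_eq_abs, Real.norm_of_nonneg hρ.le, mul_one]
        _ = t * |r'| + ρ * (t * ‖u'‖) := by ring
        _ ≤ C * ρ + ρ * 1 := by gcongr; exact hu'.trans h3.le
        _ = _ := by ring
    have hlt : ε / 2 * (t * ‖y' - x'‖) < ε / 2 * (t * (1 / 2)) := by
      calc ε / 2 * (t * ‖y' - x'‖) ≤ ε / 2 * (ρ * (C + 1)) := by gcongr
        _ = ε / 2 * ρ * (C + 1) := by ring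
        _ ≤ tangentAngle Y X (y t) * t * (C + 1) := by
            have := hviol.le.trans (mul_le_mul_of_nonneg_right hα' ht.le)
            gcongr
        _ = tangentAngle Y X (y t) * (C + 1) * t := by ring
        _ < ε / 4 * t := by gcongr
        _ = _ := by ring
    have hlt' := lt_of_mul_lt_mul_left (lt_of_mul_lt_mul_left hlt (by positivity)) ht.le
    have := one_le_norm_of_hasDerivAt ht (hnhds.mono fun s hs => hs.2) hy'
    have := norm_le_norm_add_norm_sub' y' x'
    linarith
  have hx'0 : x' ≠ 0 := fun h => by norm_num [h] at hx'norm
  -- One-dimensionality of `X` turns the extremal direction `v` into a multiple of the velocity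
  -- `x'`.
  obtain ⟨c, rfl⟩ := hX.exists_eq_smul htX.1 hv hx'T hx'0
  have hc : |c| ≤ 2 := by
    rw [norm_smul, Real.norm_eq_abs] at hv1
    nlinarith [abs_nonneg c]
  -- Since `y'` is orthogonal to `u`, only `y' - x'` contributes: its radial part is controlled by
  -- `β` and its angular part by `ω`.
  have hx'u : |t * inner ℝ x' u| ≤ ρ * (ε / 4) := by
    have hy'u : inner ℝ y' u = 0 := (Submodule.mem_orthogonal _ _).1 hu _ hy'T
    have : inner ℝ x' u = -(r' * inner ℝ U u + ρ * inner ℝ u' u) := by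
      rw [show x' = y' - (y' - x') by abel, hdec, inner_sub_left, hy'u, inner_add_left,
        real_inner_smul_left, real_inner_smul_left, zero_sub]
    calc |t * inner ℝ x' u| ≤ t * (|r'| * |inner ℝ U u| + ρ * |inner ℝ u' u|) := by
          rw [this, abs_mul, abs_of_pos ht, abs_neg]
          gcongr
          refine (abs_add_le _ _).trans (le_of_eq ?_)
          rw [abs_mul, abs_mul, abs_of_pos hρ]
      _ ≤ t * (|r'| * secantAngle Y X (y t) + ρ * ‖u'‖) := by
          gcongr
          simpa [hu1] using abs_real_inner_le_norm u' u
      _ = (t * |r'|) * secantAngle Y X (y t) + ρ * (t * ‖u'‖) := by ring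
      _ ≤ (C * ρ) * secantAngle Y X (y t) + ρ * ω t := by
          gcongr
          exact (abs_nonneg _).trans hβ'
      _ = ρ * (C * secantAngle Y X (y t) + ω t) := by ring
      _ ≤ _ := by gcongr
  refine absurd hviol (not_lt.2 ?_)
  calc inner ℝ (c • x') u * t = c * (t * inner ℝ x' u) := by rw [real_inner_smul_left]; ring
    _ ≤ |c| * |t * inner ℝ x' u| := by rw [← abs_mul]; exact le_abs_self _
    _ ≤ 2 * (ρ * (ε / 4)) := by gcongr
    _ = _ := by ring
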